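/- Let $n\ge 1$ and $q\ge 2$ be integers and $\mathbf q=\{0,1,\dots,q-1\}$. Binomial coefficients $\binom rs$ with integers $r,s$ are $0$ unless $0\le s\le r$; a summand containing a vanishing binomial coefficient is read as $0$, and $0^0=1$. For $\mathbf x\in\mathbf q^n$ let $S(\mathbf x)=\{h:\mathbf x_h\ne0\}$, and for $\mathbf x,\mathbf y\in\mathbf q^n$ let $\langle\mathbf x,\mathbf y\rangle=\sum_{h=1}^n\mathbf x_h\mathbf y_h\in\mathbb Z_{\ge0}$. Write $\overline U=\{1,\dots,n\}\setminus U$. Let $\mathcal I(q,n)$ be the set of $(i,j,t,p)$ with $0\le p\le t\le i,j$ and $i+j\le n+t$, and in addition $p=t$ if $q=2$. Let $M_{i,j}^{t,p}$ be the $\mathbf q^n\times\mathbf q^n$ zero-one matrix whose $(\mathbf u,\mathbf v)$ entry is $1$ exactly when $|S(\mathbf u)|=i$, $|S(\mathbf v)|=j$, $|S(\mathbf u)\cap S(\mathbf v)|=t$ and $|\{h:\mathbf v_h=\mathbf u_h\neq0\}|=p$. For a finite set $V$ with $m=|V|$ and integers $i,j$, let $C_{i,j}^V$ be the zero-one matrix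 indexed by the subsets of $V$ whose $(I,J)$ entry is $1$ exactly when $|I|=i$, $|J|=j$ and ($I\subseteq J$ or $J\subseteq I$). For $0\le k\le\lfloor m/2\rfloor$ let $L_k^V=\{x\in\mathbb C^{\mathcal P(V)}: C_{k-1,k}^Vx=0,\ x_I=0\text{ if }|I|\ne k\}$. For every $V\subseteq\{1,\dots,n\}$ and every such $k$ fix an arbitrary orthonormal basis $B_k^V$ of $L_k^V$. Put $$\beta_{i,j,k}^{m,t}=\binom{m-2k}{i-k}\sum_{p=0}^m(-1)^{k-p}\binom kp\binom{i-p}{t-p}\binom{m+p-i-k}{m+t-i-j}.$$ Let $\phi\in\mathbb C$ be a primitive $(q-1)$-th root of unity. Let $\mathcal V$ be the set of tuples $(a,k,i,\mathbf a,b)$ with integers $0\le a\le k\le i\le n+a-k$, a word $\mathbf a\in\mathbf q^n$ with $|S(\mathbf a)|=a$ and $\mathbf a_h\ne q-1$ for all $h$, and $b\in B_{k-a}^{\overline{S(\mathbf a)}}$. For such a tuple define $\Psi_{\mathbf a,b}^{a,k,i}\in\mathbb C^{\mathbf q^n}$ by $$(\Psi_{\mathbf a,b}^{a,k,i})_{\mathbf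 x}=(q-1)^{-\frac i2}\binom{n+a-2k}{i-k}^{-\frac12}\phi^{\langle\mathbf a,\mathbf x\rangle}\bigl(C_{i-a,k-a}^{\overline{S(\mathbf a)}}\,b\bigr)_{S(\mathbf x)\setminus S(\mathbf a)}\quad\text{if }S(\mathbf a)\subseteq S(\mathbf x),$$ and $(\Psi_{\mathbf a,b}^{a,k,i})_{\mathbf x}=0$ otherwise. Put $$\alpha(i,j,t,p,a,k)=\beta_{i-a,j-a,k-a}^{n-a,t-a}\,(q-1)^{\frac12(i+j)-t}\sum_{g=0}^p(-1)^{a-g}\binom ag\binom{t-a}{p-g}(q-2)^{t-a-p+g}.$$ Then the vectors $\Psi_{\mathbf a,b}^{a,k,i}$, $(a,k,i,\mathbf a,b)\in\mathcal V$, form an orthonormal basis of $\mathbb C^{\mathbf q^n}$. Moreover, for all $(i,j,t,p)\in\mathcal I(q,n)$ and $(a,k,i',\mathbf a,b)\in\mathcal V$: if $k\le j\le n+a-k$, then $$M_{j,i}^{t,p}\,\Psi_{\mathbf a,b}^{a,k,i'}=\delta_{i,i'}\binom{n+a-2k}{i-k}^{-\frac12}\binom{n+a-2k}{j-k}^{-\frac12}\alpha(i,j,t,p,a,k)\,\Psi_{\mathbf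 a,b}^{a,k,j}$$ (the right-hand side being $0$ if $i\neq i'$), and if $j<k$ or $j>n+a-k$, then $M_{j,i}^{t,p}\,\Psi_{\mathbf a,b}^{a,k,i'}=0$. -/

import Mathlib

namespace HammingTerwilliger

/-- The binomial coefficient `r` choose `s` for integers `r`, `s`, with value `0` unless
`0 ≤ s ≤ r`. -/
def binom (r s : ℤ) : ℕ :=
  if 0 ≤ s ∧ s ≤ r then r.toNat.choose s.toNat else 0

/-- Words of length `n` over the alphabet `{0, …, q - 1}`. -/
abbrev Word (n q : ℕ) : Type := Fin n → Fin q

/-- The support of a word: the set of positions of its nonzero letters. -/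
def supp {n q : ℕ} (x : Word n q) : Finset (Fin n) :=
  Finset.univ.filter fun h => (x h : ℕ) ≠ 0

/-- The nonnegative integer `∑ h, x h * y h` (not reduced modulo anything). -/
def pairing {n q : ℕ} (x y : Word n q) : ℕ := ∑ h, (x h : ℕ) * (y h : ℕ)

/-- The index set of the four-tuples `(i, j, t, p)`. -/
def tuples (q n : ℕ) : Set (ℕ × ℕ × ℕ × ℕ) :=
  {d | match d with
    | (i, j, t, p) => p ≤ t ∧ t ≤ i ∧ t ≤ j ∧ i + j ≤ n + t ∧ (q = 2 → p = t)}

/-- The zero-one matrix `M_{i,j}^{t,p}`, with rows and columns indexed by words. -/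
def M (n q i j t p : ℕ) : Matrix (Word n q) (Word n q) ℂ :=
  Matrix.of fun u v =>
    if (supp u).card = i ∧ (supp v).card = j ∧ (supp u ∩ supp v).card = t ∧
        (Finset.univ.filter fun h => v h = u h ∧ (u h : ℕ) ≠ 0).card = p
    then 1 else 0

/-- The matrix `C_{i,j}^V`, with rows and columns indexed by the subsets of `V`. The indices are
integers, so that `C_{-1,0}^V = 0`. -/
def C (V : Type*) [Fintype V] [DecidableEq V] (i j : ℤ) : Matrix (Finset V) (Finset V) ℂ :=
  Matrix.of fun I J =>
    if (I.card : ℤ) = i ∧ (J.card : ℤ) = j ∧ (I ⊆ J ∨ J ⊆ I) then 1 else 0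

/-- The space `L_k^V` of the vectors in the kernel of `C_{k-1,k}^V` that are supported on the
subsets of `V` of cardinality `k`. -/
def L (V : Type*) [Fintype V] [DecidableEq V] (k : ℕ) :
    Submodule ℂ (EuclideanSpace ℂ (Finset V)) where
  carrier := {x | (C V ((k : ℤ) - 1) k).mulVec x.ofLp = 0 ∧ ∀ I : Finset V, I.card ≠ k → x I = 0}
  add_mem' := by
    rintro x y ⟨hx, hx'⟩ ⟨hy, hy'⟩
    refine ⟨?_, fun I hI => ?_⟩
    · rw [WithLp.ofLp_add, Matrix.mulVec_add, hx, hy, add_zero]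
    · rw [PiLp.add_apply, hx' I hI, hy' I hI, add_zero]
  zero_mem' := by
    refine ⟨?_, fun I _ => rfl⟩
    rw [WithLp.ofLp_zero, Matrix.mulVec_zero]
  smul_mem' := by
    rintro c x ⟨hx, hx'⟩
    refine ⟨?_, fun I hI => ?_⟩
    · rw [WithLp.ofLp_smul, Matrix.mulVec_smul, hx, smul_zero]
    · rw [PiLp.smul_apply, hx' I hI, smul_zero]

/-- `B` is an orthonormal base of the subspace `K` of an inner product space. -/
def IsOrthonormalBase {E : Type*} [NormedAddCommGroup E] [InnerProductSpace ℂ E]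
    (B : Set E) (K : Submodule ℂ E) : Prop :=
  Orthonormal ℂ ((↑) : B → E) ∧ Submodule.span ℂ B = K

/-- For every subset `W` of the `n` positions and every `k`, a set of vectors indexed by the
subsets of `W`. -/
abbrev BaseFamily (n : ℕ) : Type :=
  ∀ (W : Finset (Fin n)) (_ : ℕ), Set (EuclideanSpace ℂ (Finset W))

/-- The family consists of an orthonormal base of `L_k^W` for all `W` and `k ≤ ⌊|W| / 2⌋`. -/
def BaseFamily.IsAdmissible {n : ℕ} (B : BaseFamily n) : Prop :=
  ∀ (W : Finset (Fin n)) (k : ℕ), k ≤ W.card / 2 → IsOrthonormalBase (B W k) (L W k)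

/-- The numbers `β_{i,j,k}^{m,t}`. -/
noncomputable def beta (m : ℕ) (t i j k : ℤ) : ℝ :=
  (binom (m - 2 * k) (i - k) : ℝ) *
    ∑ p ∈ Finset.range (m + 1), (-1 : ℝ) ^ (k - p) * (binom k p : ℝ) *
      (binom (i - p) (t - p) : ℝ) * (binom (m + p - i - k) (m + t - i - j) : ℝ)

/-- The numbers `α(i,j,t,p,a,k)`, for words of length `n` over an alphabet of size `q`. -/
noncomputable def alpha (n q i j t p a k : ℕ) : ℝ :=
  beta (n - a) ((t : ℤ) - a) ((i : ℤ) - a) ((j : ℤ) - a) ((k : ℤ) - a) *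
    ((q : ℝ) - 1) ^ (((i : ℝ) + j) / 2 - t) *
    ∑ g ∈ Finset.range (p + 1), (-1 : ℝ) ^ ((a : ℤ) - g) * (binom a g : ℝ) *
      (binom ((t : ℤ) - a) ((p : ℤ) - g) : ℝ) * ((q : ℝ) - 2) ^ ((t : ℤ) - a - p + g)

/-- The index set of the vectors `Ψ`: the tuples `(a, k, i, w, b)`. -/
structure Index (n q : ℕ) (B : BaseFamily n) where
  a : ℕ
  k : ℕ
  i : ℕ
  w : Word n q
  b : EuclideanSpace ℂ (Finset ↥(supp w)ᶜ)
  a_le_k : a ≤ k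
  k_le_i : k ≤ i
  i_le : (i : ℤ) ≤ n + a - k
  card_supp : (supp w).card = a
  letter_ne : ∀ h, (w h : ℕ) ≠ q - 1
  b_mem : b ∈ B (supp w)ᶜ (k - a)

/-- The vector `Ψ_{w,b}^{a,k,i}`. Here `supp x \ supp w` is regarded as a subset of the complement
of `supp w`. -/
noncomputable def Psi {n q : ℕ} (φ : ℂ) (a k i : ℕ) (w : Word n q)
    (b : EuclideanSpace ℂ (Finset ↥(supp w)ᶜ)) : EuclideanSpace ℂ (Word n q) :=
  WithLp.toLp 2 fun x =>
    if supp w ⊆ supp x then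
      ((((q : ℝ) - 1) ^ (-(i : ℝ) / 2) *
          (binom ((n : ℤ) + a - 2 * k) ((i : ℤ) - k) : ℝ) ^ (-(1 / 2) : ℝ) : ℝ) : ℂ) *
        φ ^ pairing w x *
        (C ↥(supp w)ᶜ ((i : ℤ) - a) ((k : ℤ) - a)).mulVec b.ofLp
          ((supp x).subtype (· ∈ (supp w)ᶜ))
    else 0

end HammingTerwilliger

/-!
The proof separates the supports of words from their letters.

Supports. Fix a finite set `V` with `m` elements. A vector of `L_k^V` is a harmonic function `b` of
degree `k` on the subsets of `V`: its sums over the sets containing a fixed smaller set vanish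
(`IsHarmonic`, `mem_L_iff`). The copy of `b` in layer `i` is `C_{i,k}^V b`, that is, the function
`upSum b` restricted to the `i`-sets. Everything about these copies comes from the enumerator
`∑ I, b I * Y ^ |I ∩ X| = (Y - 1) ^ k * upSum b X` (`IsHarmonic.sum_X_pow`). It shows that the
relation `|Y ∩ U| = t` between `i`-sets `Y` and `j`-sets `U` maps the copy in layer `i` to a
multiple of the copy in layer `j` (`IsHarmonic.sum_upSum`), and the scalar `layerCoeff` is read off
by counting. For `U` in layer `k` this yields the inner products of the copies
(`IsHarmonic.orthogonal`, `IsHarmonic.sum_conj_mul_self`); with these, the symmetry of the relation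
becomes the symmetry of `beta` in `i` and `j` (`IsHarmonic.beta_symm`), which identifies
`layerCoeff` with the coefficient of the theorem. No dimension is computed: a function on the
`i`-sets orthogonal to all copies has vanishing sums over the supersets of each small set, and
inclusion-exclusion shows that it is zero (`eq_zero_of_orthogonal`).

Letters. On the words of a fixed support `X` the functions `φ ^ ⟨w, x⟩`, for `w` supported in `X`
and without the letter `q - 1`, satisfy both orthogonality relations of the characters of a cyclic
group of order `q - 1` in each coordinate (`sum_conj_pairing`, `sum_pairing_conj`). The sum of such
a character over the words of support `Y` that agree with `u` in exactly `p` nonzero letters is a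
coefficient of a product over the positions (`sum_agreement_X_pow`). It vanishes unless the support
of `w` lies in the support of `u`, so only the subsets of the complement of the support of `w`
remain, and there the first part applies (`inner_Psi_Psi`, `M_Psi_apply`).
-/

namespace HammingTerwilliger

open Finset ComplexConjugate

/-! ### Counting sets between two sets -/

theorem card_filter_between {V : Type*} [DecidableEq V] {A B : Finset V} (hAB : A ⊆ B) (s : ℕ) :
    (B.powerset.filter fun Z => A ⊆ Z ∧ Z.card = s).card =
      binom ((B.card : ℤ) - A.card) ((s : ℤ) - A.card) := by
  by_cases hs : A.card ≤ s
  · have h1 : (B.powerset.filter fun Z => A ⊆ Z ∧ Z.card = s).card =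
        (powersetCard (s - A.card) (B \ A)).card := by
      refine card_nbij' (fun Z => Z \ A) (fun W => W ∪ A) ?_ ?_ ?_ ?_
      · intro Z hZ
        simp only [coe_filter, mem_powerset, Set.mem_ofPred_eq] at hZ
        refine mem_coe.mpr (mem_powersetCard.mpr ⟨sdiff_subset_sdiff hZ.1 le_rfl, ?_⟩)
        rw [card_sdiff_of_subset hZ.2.1, hZ.2.2]
      · intro W hW
        have hW := mem_powersetCard.mp (mem_coe.mp hW)
        have hd : Disjoint W A := disjoint_of_subset_left hW.1 sdiff_disjoint
        simp only [coe_filter, mem_powerset, Set.mem_ofPred_eq]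
        refine ⟨union_subset (hW.1.trans sdiff_subset) hAB, subset_union_right, ?_⟩
        rw [card_union_of_disjoint hd]; omega
      · intro Z hZ
        simp only [coe_filter, mem_powerset, Set.mem_ofPred_eq] at hZ
        exact sdiff_union_of_subset hZ.2.1
      · intro W hW
        have hW := mem_powersetCard.mp (mem_coe.mp hW)
        have hd : Disjoint W A := disjoint_of_subset_left hW.1 sdiff_disjoint
        exact union_sdiff_cancel_right hd
    rw [h1, card_powersetCard, card_sdiff_of_subset hAB, binom]
    have h2 := card_le_card hAB
    have e1 : ((B.card : ℤ) - A.card).toNat = B.card - A.card := by omega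
    have e2 : ((s : ℤ) - A.card).toNat = s - A.card := by omega
    split_ifs with h
    · rw [e1, e2]
    · rw [Nat.choose_eq_zero_of_lt]; omega
  · rw [binom, if_neg (by omega), card_eq_zero, filter_eq_empty_iff]
    rintro Z - ⟨h1, h2⟩
    have := card_le_card h1
    omega

theorem binom_symm {r s : ℤ} : binom r (r - s) = binom r s := by
  unfold binom
  by_cases h : 0 ≤ s ∧ s ≤ r
  · rw [if_pos h, if_pos (by omega), show (r - s).toNat = r.toNat - s.toNat by omega,
      Nat.choose_symm (by omega)]
  · rw [if_neg h, if_neg (by omega)]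

/-- The sum occurring in `beta`. It is the scalar by which a matrix of the Johnson scheme acts
between the layers of an irreducible module, see `IsHarmonic.sum_upSum`. -/
noncomputable def layerCoeff (m : ℕ) (t i j k : ℤ) : ℝ :=
  ∑ p ∈ Finset.range (m + 1), (-1 : ℝ) ^ (k - p) * (binom k p : ℝ) *
    (binom (i - p) (t - p) : ℝ) * (binom (m + p - i - k) (m + t - i - j) : ℝ)

theorem beta_eq (m : ℕ) (t i j k : ℤ) :
    beta m t i j k = (binom (m - 2 * k) (i - k) : ℝ) * layerCoeff m t i j k := rfl

/-- The sum is a `k`-th finite difference of a binomial coefficient. -/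
theorem layerCoeff_self {m i k : ℕ} (hki : k ≤ i) (hi : i + k ≤ m) :
    layerCoeff m k k i k = (binom ((m : ℤ) - 2 * k) ((i : ℤ) - k) : ℝ) := by
  have h := congrFun (fwdDiff_iter_choose (m - i - k) k) (m - 2 * k)
  rw [fwdDiff_iter_eq_sum_shift] at h
  have h' := congrArg (Int.cast : ℤ → ℝ) h
  rw [← binom_symm, binom, if_pos (by omega)]
  have e1 : ((m : ℤ) - 2 * k).toNat = m - 2 * k := by omega
  have e2 : ((m : ℤ) - 2 * k - (i - k)).toNat = m - i - k := by omega
  rw [e1, e2]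
  rw [Int.cast_natCast] at h'
  rw [← h', layerCoeff]
  push_cast
  symm
  refine Finset.sum_subset_zero_on_sdiff (Finset.range_mono (by omega)) ?_ ?_
  · intro p hp
    simp only [Finset.mem_sdiff, Finset.mem_range] at hp
    rw [show binom (k : ℤ) p = 0 from if_neg (by omega)]
    simp
  · intro p hp
    rw [Finset.mem_range] at hp
    have e3 : (k : ℤ) - p = ((k - p : ℕ) : ℤ) := by omega
    have e4 : binom (k : ℤ) p = k.choose p := by rw [binom, if_pos (by omega)]; simp
    have e5 : binom ((k : ℤ) - p) (k - p) = 1 := by rw [binom, if_pos (by omega)]; simp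
    have e6 : binom ((m : ℤ) + p - k - k) (m + k - k - i) =
        (m - 2 * k + p).choose (k + (m - i - k)) := by
      have e7 : ((m : ℤ) + p - k - k).toNat = m - 2 * k + p := by omega
      have e8 : ((m : ℤ) + k - k - i).toNat = k + (m - i - k) := by omega
      rw [binom, e7, e8]
      split_ifs with h
      · rfl
      · rw [Nat.choose_eq_zero_of_lt]; omega
    rw [e4, e5, e6, e3, zpow_natCast]
    simp

/-! ### Harmonic functions on the subsets of a finite set -/

section Johnson

variable {V : Type*} [Fintype V] [DecidableEq V]

/-- The sum of `b` over the subsets of `X`. -/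
def upSum (b : Finset V → ℂ) (X : Finset V) : ℂ := ∑ I ∈ X.powerset, b I

/-- The sum of `b` over the sets containing `K`. -/
def downSum (b : Finset V → ℂ) (K : Finset V) : ℂ := ∑ I with K ⊆ I, b I

/-- A function on the subsets of `V` is harmonic of degree `k` if it is supported on the
`k`-subsets and its sum over the sets containing any given smaller set vanishes. -/
structure IsHarmonic (k : ℕ) (b : Finset V → ℂ) : Prop where
  eq_zero : ∀ I : Finset V, I.card ≠ k → b I = 0
  downSum_eq : ∀ K : Finset V, K.card < k → downSum b K = 0

/-- Double counting: a set `I ⊇ K` contains `insert x K` for the `|I| - |K|` elements `x` of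
`I \ K`. -/
theorem sum_downSum_insert {i : ℕ} {f : Finset V → ℂ}
    (hf : ∀ I : Finset V, I.card ≠ i → f I = 0) (K : Finset V) :
    ∑ x ∈ Kᶜ, downSum f (insert x K) = ((i : ℂ) - K.card) * downSum f K := by
  simp only [downSum, sum_filter, mul_sum]
  rw [sum_comm]
  refine sum_congr rfl fun I _ => ?_
  by_cases hK : K ⊆ I
  · have h1 : ∀ x, (insert x K ⊆ I) ↔ x ∈ I := fun x => by
      rw [insert_subset_iff]; exact and_iff_left hK
    simp only [h1, if_pos hK]
    rw [← sum_filter, sum_const, nsmul_eq_mul]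
    by_cases hI : I.card = i
    · have : ({x ∈ Kᶜ | x ∈ I} : Finset V) = I \ K := by ext; simp [and_comm]
      rw [this, card_sdiff_of_subset hK, Nat.cast_sub (card_le_card hK), hI]
    · rw [hf I hI]; simp
  · have h1 : ∀ x, ¬ (insert x K ⊆ I) := fun x h => hK ((subset_insert _ _).trans h)
    simp [h1, hK]

/-- Vanishing of the sums over the supersets of the `k - 1`-sets propagates to all smaller
sets. -/
theorem isHarmonic_of_pred {k : ℕ} {b : Finset V → ℂ}
    (h0 : ∀ I : Finset V, I.card ≠ k → b I = 0)
    (h1 : ∀ K : Finset V, K.card + 1 = k → downSum b K = 0) : IsHarmonic k b := by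
  refine ⟨h0, ?_⟩
  have key : ∀ d : ℕ, ∀ K : Finset V, K.card + 1 + d = k → downSum b K = 0 := by
    intro d
    induction d with
    | zero => exact fun K hK => h1 K hK
    | succ d ih =>
      intro K hK
      have h := sum_downSum_insert h0 K
      rw [sum_eq_zero fun x hx => ih _ (by
        rw [card_insert_of_notMem (by simpa using hx)]; omega)] at h
      rcases mul_eq_zero.mp h.symm with h | h
      · rw [sub_eq_zero, Nat.cast_inj] at h; omega
      · exact h
  exact fun K hK => key (k - (K.card + 1)) K (by omega)

theorem C_mulVec_of_le (b : Finset V → ℂ) {i k : ℤ} (hki : k ≤ i)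
    (hb : ∀ I : Finset V, (I.card : ℤ) ≠ k → b I = 0) (X : Finset V) :
    (C V i k).mulVec b X = if (X.card : ℤ) = i then upSum b X else 0 := by
  simp only [C, Matrix.mulVec, dotProduct, Matrix.of_apply, upSum]
  split_ifs with hX
  · rw [← sum_subset (subset_univ X.powerset)]
    · refine sum_congr rfl fun I hI => ?_
      rw [mem_powerset] at hI
      by_cases h : (I.card : ℤ) = k
      · simp [hX, h, hI]
      · simp [hb I h]
    · intro I _ hI
      rw [mem_powerset] at hI
      by_cases h : (I.card : ℤ) = k
      · rw [if_neg, zero_mul]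
        rintro ⟨_, _, h' | h'⟩
        · exact hI (eq_of_subset_of_card_le h' (by omega)).ge
        · exact hI h'
      · simp [hb I h]
  · simp [hX]

theorem mem_L_iff {k : ℕ} {x : EuclideanSpace ℂ (Finset V)} :
    x ∈ L V k ↔ IsHarmonic k x.ofLp := by
  have key : (∀ I : Finset V, I.card ≠ k → x I = 0) → ∀ K : Finset V, K.card + 1 = k →
      (C V ((k : ℤ) - 1) k).mulVec x.ofLp K = downSum x.ofLp K := by
    intro h0 K hK
    simp only [C, Matrix.mulVec, dotProduct, Matrix.of_apply, downSum, sum_filter]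
    refine sum_congr rfl fun I _ => ?_
    by_cases h : I.card = k
    · have h2 : ¬ I ⊆ K := fun h' => by have := card_le_card h'; omega
      have h3 : (K.card : ℤ) = (k : ℤ) - 1 := by omega
      simp [h, h2, h3]
    · simp [h0 I h]
  constructor
  · rintro ⟨h1, h2⟩
    refine isHarmonic_of_pred h2 fun K hK => ?_
    rw [← key h2 K hK, h1]; rfl
  · rintro ⟨h1, h2⟩
    refine ⟨?_, h1⟩
    ext K
    by_cases hK : K.card + 1 = k
    · rw [key h1 K hK, h2 K (by omega)]; rfl
    · have h3 : ¬ (K.card : ℤ) = (k : ℤ) - 1 := by omega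
      simp [C, Matrix.mulVec, dotProduct, h3]

open Polynomial in
/-- The intersection enumerator of a harmonic function: expand
`Y ^ |I ∩ X| = ∑ K ⊆ I ∩ X, (Y - 1) ^ |K|` and exchange the sums; only `|K| = k` survives. -/
theorem IsHarmonic.sum_X_pow {k : ℕ} {b : Finset V → ℂ} (hb : IsHarmonic k b) (S : Finset V) :
    ∑ I, Polynomial.C (b I) * X ^ (I ∩ S).card = (X - 1) ^ k * Polynomial.C (upSum b S) := by
  have h1 : ∀ I : Finset V, (X : ℂ[X]) ^ (I ∩ S).card =
      ∑ K ∈ S.powerset, if K ⊆ I then (X - 1) ^ K.card else 0 := fun I => by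
    have := sum_pow_mul_eq_add_pow (X - 1 : ℂ[X]) 1 (I ∩ S)
    rw [sub_add_cancel] at this
    rw [← this, ← sum_filter]
    refine sum_congr ?_ fun K _ => by rw [one_pow, mul_one]
    ext K
    simp only [mem_powerset, mem_filter, subset_inter_iff]
    tauto
  have h2 : ∀ K ∈ S.powerset, ∑ I, Polynomial.C (b I) * (if K ⊆ I then (X - 1) ^ K.card else 0) =
      (X - 1) ^ k * Polynomial.C (b K) := fun K _ => by
    have h3 : ∑ I, Polynomial.C (b I) * (if K ⊆ I then (X - 1 : ℂ[X]) ^ K.card else 0) =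
        Polynomial.C (downSum b K) * (X - 1) ^ K.card := by
      simp only [downSum, map_sum, sum_mul, sum_filter]
      exact sum_congr rfl fun I _ => by split_ifs <;> simp
    rw [h3]
    rcases lt_trichotomy K.card k with h | h | h
    · rw [hb.downSum_eq K h, hb.eq_zero K h.ne]; simp
    · have : downSum b K = b K := by
        refine sum_eq_single K (fun I hI hne => hb.eq_zero I fun hI' => hne ?_) (by simp)
        rw [mem_filter] at hI
        exact (eq_of_subset_of_card_le hI.2 (by omega)).symm
      rw [this, h, mul_comm]
    · have : downSum b K = 0 := sum_eq_zero fun I hI => hb.eq_zero I fun hI' => by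
        have := card_le_card (mem_filter.mp hI).2
        omega
      rw [this, hb.eq_zero K h.ne']; simp
  simp_rw [h1, mul_sum]
  rw [sum_comm, sum_congr rfl h2, upSum, map_sum, mul_sum]

/-- The coefficient of `Y ^ r` in the intersection enumerator. -/
theorem IsHarmonic.sum_card_inter {k : ℕ} {b : Finset V → ℂ} (hb : IsHarmonic k b)
    (X : Finset V) (r : ℕ) :
    ∑ I with (I ∩ X).card = r, b I =
      (-1 : ℂ) ^ ((k : ℤ) - r) * (binom k r : ℂ) * upSum b X := by
  have h := congrArg (fun P => Polynomial.coeff P r) (hb.sum_X_pow X)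
  have e : (Polynomial.X - 1 : Polynomial ℂ) = Polynomial.X + Polynomial.C (-1) := by
    simp [sub_eq_add_neg]
  simp only [Polynomial.finsetSum_coeff, Polynomial.coeff_C_mul, Polynomial.coeff_X_pow,
    Polynomial.coeff_mul_C, e, Polynomial.coeff_X_add_C_pow] at h
  rw [sum_filter]
  refine Eq.trans (sum_congr rfl fun I _ => ?_) (h.trans ?_)
  · by_cases h : (I ∩ X).card = r
    · simp [h]
    · simp [h, Ne.symm h]
  · congr 1
    by_cases hr : r ≤ k
    · have : (k : ℤ) - r = ((k - r : ℕ) : ℤ) := by omega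
      rw [this, zpow_natCast, binom, if_pos (by omega)]; simp
    · rw [Nat.choose_eq_zero_of_lt (by omega), binom, if_neg (by omega)]; simp

theorem IsHarmonic.upSum_eq {k : ℕ} {b : Finset V → ℂ} (hb : IsHarmonic k b) {X : Finset V}
    (hX : X.card = k) : upSum b X = b X := by
  refine sum_eq_single X (fun I hI hne => hb.eq_zero I fun hI' => hne ?_) (by simp)
  exact eq_of_subset_of_card_le (mem_powerset.mp hI) (by omega)

/-- The copies of a harmonic function of degree `k` live in the layers from `k` to `m - k`. -/
theorem IsHarmonic.upSum_eq_zero {k : ℕ} {b : Finset V → ℂ} (hb : IsHarmonic k b) {X : Finset V}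
    (hX : ¬ (k ≤ X.card ∧ X.card + k ≤ Fintype.card V)) : upSum b X = 0 := by
  by_cases h : k ≤ X.card
  · -- A `k`-set has no room outside `X`, so the constant term of the enumerator vanishes.
    have h1 := hb.sum_card_inter X 0
    rw [sum_eq_zero, eq_comm, mul_eq_zero, mul_eq_zero] at h1
    · rcases h1 with (h1 | h1) | h1
      · exact absurd h1 (zpow_ne_zero _ (by norm_num))
      · simp [binom] at h1
      · exact h1
    · intro I hI
      refine hb.eq_zero I fun hI' => ?_
      have h2 := card_union_add_card_inter I X
      have h3 := card_le_univ (I ∪ X)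
      have h4 := (mem_filter.mp hI).2
      omega
  · exact sum_eq_zero fun I hI => hb.eq_zero I fun hI' => by
      have := card_le_card (mem_powerset.mp hI)
      omega

/-- The number of `i`-sets `Y ⊇ I` with `|Y ∩ U| = t`: the sets `Y ∩ U` and `Y \ U` are chosen
independently. The second binomial coefficient counts the complement of `Y` outside `U`. -/
theorem card_filter_superset_inter (I U : Finset V) {i t : ℕ} (hti : t ≤ i) :
    (univ.filter fun Y : Finset V => I ⊆ Y ∧ Y.card = i ∧ (Y ∩ U).card = t).card =
      binom ((U.card : ℤ) - (I ∩ U).card) ((t : ℤ) - (I ∩ U).card) *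
        binom ((Fintype.card V : ℤ) + (I ∩ U).card - U.card - I.card)
          ((Fintype.card V : ℤ) + t - U.card - i) := by
  have h1 := card_filter_between (inter_subset_right : I ∩ U ⊆ U) t
  have h2 := card_filter_between (show I \ U ⊆ Uᶜ from fun x hx => by
    simpa using (mem_sdiff.mp hx).2) (i - t)
  have hc := card_inter_add_card_sdiff I U
  have hU := card_add_card_compl U
  rw [← binom_symm] at h2
  have e1 : ((Uᶜ.card : ℤ) - (I \ U).card) =
    (Fintype.card V : ℤ) + (I ∩ U).card - U.card - I.card := by omega
  have e2 : ((Uᶜ.card : ℤ) - (I \ U).card) - (((i - t : ℕ) : ℤ) - (I \ U).card) =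
    (Fintype.card V : ℤ) + t - U.card - i := by omega
  rw [e2, e1] at h2
  rw [← h1, ← h2, ← card_product]
  refine card_nbij' (fun Y => (Y ∩ U, Y \ U)) (fun Z => Z.1 ∪ Z.2) ?_ ?_ ?_ ?_
  · intro Y hY
    simp only [coe_filter, mem_univ, true_and, Set.mem_ofPred_eq] at hY
    obtain ⟨hIY, hc1, hc2⟩ := hY
    have := card_inter_add_card_sdiff Y U
    simp only [coe_product, Set.mem_prod, coe_filter, mem_powerset, Set.mem_ofPred_eq]
    refine ⟨⟨inter_subset_right, inter_subset_inter_right hIY, hc2⟩, ?_,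
      sdiff_subset_sdiff hIY le_rfl, by omega⟩
    intro x hx
    simpa using (mem_sdiff.mp hx).2
  · rintro ⟨Z, W⟩ hZ
    simp only [coe_product, Set.mem_prod, coe_filter, mem_powerset, Set.mem_ofPred_eq] at hZ
    obtain ⟨⟨hZU, hIZ, hZ⟩, hWU, hIW, hW⟩ := hZ
    have hd : Disjoint Z W := disjoint_of_subset_left hZU
      (disjoint_of_subset_right hWU disjoint_compl_right)
    simp only [coe_filter, mem_univ, true_and, Set.mem_ofPred_eq]
    refine ⟨?_, ?_, ?_⟩
    · rw [← sup_inf_sdiff I U]; exact union_subset_union hIZ hIW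
    · rw [card_union_of_disjoint hd]; omega
    · rw [union_inter_distrib_right, inter_eq_left.mpr hZU,
        disjoint_iff_inter_eq_empty.mp (disjoint_of_subset_left hWU disjoint_compl_left),
        union_empty, hZ]
  · intro Y _
    exact sup_inf_sdiff Y U
  · rintro ⟨Z, W⟩ hZ
    simp only [coe_product, Set.mem_prod, coe_filter, mem_powerset, Set.mem_ofPred_eq] at hZ
    obtain ⟨⟨hZU, -, -⟩, hWU, -, -⟩ := hZ
    have h3 : W ∩ U = ∅ :=
      disjoint_iff_inter_eq_empty.mp (disjoint_of_subset_left hWU disjoint_compl_left)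
    have h4 : W \ U = W := sdiff_eq_self_of_disjoint (disjoint_iff_inter_eq_empty.mpr h3)
    simp only [union_inter_distrib_right, union_sdiff_distrib, inter_eq_left.mpr hZU, h3, h4,
      sdiff_eq_empty_iff_subset.mpr hZU, union_empty, empty_union]

/-! ### The layers of the Johnson scheme -/

/-- The zero-one matrix of the relation `|Y ∩ U| = t` between `i`-sets and `j`-sets maps the copy
of a harmonic function in layer `i` to a multiple of its copy in layer `j`. -/
theorem IsHarmonic.sum_upSum {k : ℕ} {b : Finset V → ℂ} (hb : IsHarmonic k b) (U : Finset V)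
    {i t : ℕ} (hti : t ≤ i) :
    ∑ Y with Y.card = i ∧ (Y ∩ U).card = t, upSum b Y =
      layerCoeff (Fintype.card V) t U.card i k * upSum b U := by
  have h1 : ∀ Y : Finset V, upSum b Y = ∑ I, if I ⊆ Y then b I else 0 := fun Y => by
    rw [upSum, ← sum_filter]
    exact sum_congr (by ext; simp) fun _ _ => rfl
  simp_rw [h1]
  rw [sum_comm]
  have h2 : ∀ I : Finset V,
      ∑ Y with Y.card = i ∧ (Y ∩ U).card = t, (if I ⊆ Y then b I else 0) =
        ∑ r ∈ range (Fintype.card V + 1), if (I ∩ U).card = r then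
          ((binom ((U.card : ℤ) - r) ((t : ℤ) - r) *
            binom ((Fintype.card V : ℤ) + r - U.card - k) ((Fintype.card V : ℤ) + t - U.card - i)
              : ℕ) : ℂ) * b I else 0 := fun I => by
    rw [sum_ite_eq, if_pos (mem_range.mpr (Nat.lt_succ_of_le (card_le_univ _))), ← sum_filter,
      sum_const, nsmul_eq_mul]
    by_cases hI : I.card = k
    · rw [← hI, ← card_filter_superset_inter I U hti, filter_filter]
      congr 4
      ext Y
      tauto
    · rw [hb.eq_zero I hI]; simp
  rw [sum_congr rfl fun I _ => h2 I, sum_comm, ← h1, layerCoeff, Complex.ofReal_sum, sum_mul]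
  refine sum_congr rfl fun r _ => ?_
  rw [← sum_filter, ← mul_sum, hb.sum_card_inter]
  push_cast
  ring

/-- `upSum` and `downSum` are adjoint. -/
theorem sum_conj_upSum_mul (b g : Finset V → ℂ) :
    ∑ Y, conj (upSum b Y) * g Y = ∑ I, conj (b I) * downSum g I := by
  simp only [upSum, downSum, map_sum, sum_mul, mul_sum]
  rw [sum_comm' (t' := univ) (s' := fun I => univ.filter (I ⊆ ·)) (by simp)]

/-- The inner product of two copies in layer `i`. By adjointness it moves down to layer `k`, where
the sum over the supersets of `I` is the case `t = k` of `IsHarmonic.sum_upSum`. -/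
theorem IsHarmonic.sum_conj_mul {k k' : ℕ} {b b' : Finset V → ℂ} (hb : IsHarmonic k b)
    (hb' : IsHarmonic k' b') {i : ℕ} (hki : k ≤ i) :
    ∑ Y with Y.card = i, conj (upSum b Y) * upSum b' Y =
      layerCoeff (Fintype.card V) k k i k' * ∑ I with I.card = k, conj (b I) * upSum b' I := by
  have h1 := sum_conj_upSum_mul b (fun Y => if Y.card = i then upSum b' Y else 0)
  simp only [mul_ite, mul_zero] at h1
  rw [sum_filter, h1, mul_sum, sum_filter]
  refine sum_congr rfl fun I _ => ?_
  by_cases hI : I.card = k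
  · have h2 : downSum (fun Y => if Y.card = i then upSum b' Y else 0) I =
        ∑ Y with Y.card = i ∧ (Y ∩ I).card = k, upSum b' Y := by
      rw [downSum, ← sum_filter, filter_filter]
      refine sum_congr (filter_congr fun Y _ => ?_) fun _ _ => rfl
      rw [and_comm, and_congr_right_iff]
      rintro -
      constructor
      · intro h; rw [inter_eq_right.mpr h, hI]
      · intro h
        exact inter_eq_right.mp (eq_of_subset_of_card_le inter_subset_right (by omega))
    rw [if_pos hI, h2, hb'.sum_upSum I hki, hI]
    ring
  · rw [if_neg hI, hb.eq_zero I hI, map_zero, zero_mul]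

/-- The copies of harmonic functions of different degrees in one layer are orthogonal. -/
theorem IsHarmonic.orthogonal {k k' : ℕ} {b b' : Finset V → ℂ} (hb : IsHarmonic k b)
    (hb' : IsHarmonic k' b') (hkk : k ≠ k') {i : ℕ} (hki : k ≤ i) (hki' : k' ≤ i) :
    ∑ Y with Y.card = i, conj (upSum b Y) * upSum b' Y = 0 := by
  wlog h : k < k' generalizing k k' b b'
  · have h1 := congrArg conj (this hb' hb hkk.symm hki' hki (by omega))
    rw [map_zero, map_sum] at h1
    rw [← h1]
    exact sum_congr rfl fun Y _ => by rw [map_mul, Complex.conj_conj, mul_comm]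
  · rw [hb.sum_conj_mul hb' hki, sum_eq_zero, mul_zero]
    intro I hI
    rw [hb'.upSum_eq_zero (by have := (mem_filter.mp hI).2; omega), mul_zero]

theorem IsHarmonic.sum_conj_mul_self {k : ℕ} {b b' : Finset V → ℂ} (hb : IsHarmonic k b)
    (hb' : IsHarmonic k b') {i : ℕ} (hki : k ≤ i) (hi : i + k ≤ Fintype.card V) :
    ∑ Y with Y.card = i, conj (upSum b Y) * upSum b' Y =
      (binom ((Fintype.card V : ℤ) - 2 * k) ((i : ℤ) - k) : ℂ) * ∑ I, conj (b I) * b' I := by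
  rw [hb.sum_conj_mul hb' hki, layerCoeff_self hki hi, Complex.ofReal_natCast, sum_filter]
  congr 1
  refine sum_congr rfl fun I _ => ?_
  by_cases hI : I.card = k
  · rw [if_pos hI, hb'.upSum_eq hI]
  · rw [if_neg hI, hb.eq_zero I hI, map_zero, zero_mul]

/-- The relation `|Y ∩ U| = t` is symmetric, so evaluating its sesquilinear form at the copies of
one harmonic function in layers `i` and `j` in two ways exhibits `beta` as symmetric in `i`
and `j`. -/
theorem IsHarmonic.beta_symm {k : ℕ} {b : Finset V → ℂ} (hb : IsHarmonic k b)
    (hb0 : ∑ I, conj (b I) * b I ≠ 0) {i j t : ℕ} (hti : t ≤ i) (htj : t ≤ j)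
    (hki : k ≤ i) (hi : i + k ≤ Fintype.card V) (hkj : k ≤ j) (hj : j + k ≤ Fintype.card V) :
    beta (Fintype.card V) t i j k = beta (Fintype.card V) t j i k := by
  have key : ∀ i j : ℕ, t ≤ i → k ≤ j → j + k ≤ Fintype.card V →
      ∑ U with U.card = j, conj (upSum b U) *
        ∑ Y with Y.card = i ∧ (Y ∩ U).card = t, upSum b Y =
      beta (Fintype.card V) t j i k * ∑ I, conj (b I) * b I := by
    intro i j hti hkj hj
    rw [beta_eq, Complex.ofReal_mul, Complex.ofReal_natCast, mul_right_comm,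
      ← hb.sum_conj_mul_self hb hkj hj, sum_mul]
    refine sum_congr rfl fun U hU => ?_
    rw [hb.sum_upSum U hti, (mem_filter.mp hU).2]
    ring
  have h1 := key i j hti hkj hj
  have h2 := congrArg conj (key j i htj hki hi)
  rw [map_mul, Complex.conj_ofReal, map_sum, map_sum] at h2
  have h3 : ∑ I, conj (conj (b I) * b I) = ∑ I, conj (b I) * b I :=
    sum_congr rfl fun I _ => by rw [map_mul, Complex.conj_conj, mul_comm]
  rw [h3] at h2
  have h4 := h2.symm.trans (Eq.trans ?_ h1)
  · exact_mod_cast mul_right_cancel₀ hb0 h4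
  · simp only [map_mul, map_sum, Complex.conj_conj, mul_sum]
    rw [sum_comm' (t' := univ.filter fun Y => Y.card = j)
      (s' := fun U => univ.filter fun Y => Y.card = i ∧ (Y ∩ U).card = t)]
    · exact sum_congr rfl fun U _ => sum_congr rfl fun Y _ => mul_comm _ _
    · intro Y U
      simp only [mem_filter, mem_univ, true_and]
      rw [inter_comm]
      tauto

/-- A function on the `i`-sets orthogonal to the copies in layer `i` of all harmonic functions
vanishes. Degree by degree, its sums over the supersets of a `k`-set form a harmonic function
orthogonal to all harmonic functions, hence zero; inclusion-exclusion over the complement of an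
`i`-set then recovers the values. -/
theorem eq_zero_of_orthogonal {B : ℕ → Set (EuclideanSpace ℂ (Finset V))}
    (hB : ∀ k, k ≤ Fintype.card V / 2 → Submodule.span ℂ (B k) = L V k) {i : ℕ}
    {f : Finset V → ℂ} (hf : ∀ I : Finset V, I.card ≠ i → f I = 0)
    (h : ∀ k, k ≤ i → i + k ≤ Fintype.card V → ∀ b ∈ B k,
      ∑ Y, conj (upSum b.ofLp Y) * f Y = 0) (I : Finset V) : f I = 0 := by
  have key : ∀ k, k ≤ i → i + k ≤ Fintype.card V → ∀ K : Finset V, K.card = k →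
      downSum f K = 0 := by
    intro k
    induction k using Nat.strong_induction_on with
    | _ k ih =>
      intro hki hik K hK
      -- The sums of `f` over the supersets of the `k`-sets. The previous degree makes this function
      -- harmonic, and it is orthogonal to `B k` because `downSum` is adjoint to `upSum`.
      set g : EuclideanSpace ℂ (Finset V) :=
        WithLp.toLp 2 fun K => if K.card = k then downSum f K else 0 with hg
      have hgL : g ∈ L V k := by
        rw [mem_L_iff]
        refine isHarmonic_of_pred (fun J hJ => by simp [hg, hJ]) fun J hJ => ?_
        have h1 : downSum g.ofLp J = ∑ x ∈ Jᶜ, downSum f (insert x J) := by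
          simp only [downSum, hg, ← sum_filter]
          rw [filter_filter]
          symm
          refine sum_nbij (fun x => insert x J) ?_ ?_ ?_ fun x _ => rfl
          · intro x hx
            rw [mem_compl] at hx
            simp [card_insert_of_notMem hx, hJ]
          · intro x hx y hy hxy
            rw [mem_coe, mem_compl] at hx hy
            have h2 : x ∈ insert y J := by
              rw [← show insert x J = insert y J from hxy]; exact mem_insert_self _ _
            exact (mem_insert.mp h2).resolve_right hx
          · intro S hS
            obtain ⟨hS1, hS2⟩ := (mem_filter.mp (mem_coe.mp hS)).2
            obtain ⟨x, hx⟩ := card_eq_one.mp (show (S \ J).card = 1 by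
              rw [card_sdiff_of_subset hS1]; omega)
            have hx' : x ∈ S \ J := by rw [hx]; exact mem_singleton_self x
            refine ⟨x, by simpa using (mem_sdiff.mp hx').2, ?_⟩
            show insert x J = S
            rw [insert_eq, ← hx, sdiff_union_of_subset hS1]
        rw [h1, sum_downSum_insert hf, ih J.card (by omega) (by omega) (by omega) J rfl, mul_zero]
      have horth : ∀ b ∈ Submodule.span ℂ (B k), inner ℂ b g = 0 := by
        intro b hb
        induction hb using Submodule.span_induction with
        | mem b hb =>
          rw [← h k hki hik b hb, sum_conj_upSum_mul, PiLp.inner_apply]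
          have hbh : IsHarmonic k b.ofLp :=
            mem_L_iff.mp (hB k (by omega) ▸ Submodule.subset_span hb)
          refine sum_congr rfl fun J _ => ?_
          by_cases hJ : J.card = k
          · simp [hg, hJ, mul_comm]
          · simp [hbh.eq_zero J hJ]
        | zero => exact inner_zero_left _
        | add x y _ _ hx hy => rw [inner_add_left, hx, hy, add_zero]
        | smul c x _ hx => rw [inner_smul_left, hx, mul_zero]
      have hg0 : g = 0 := inner_self_eq_zero.mp
        (horth g (by rw [hB k (by omega)]; exact hgL))
      have h5 : g K = 0 := by rw [hg0]; rfl
      simpa [hg, hK] using h5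
  by_cases hI : I.card = i
  · -- A subset `K` of `Iᶜ` has at most `m - i` elements, so either `key` applies or `K` is too large
    -- to lie in an `i`-set. On the other hand it is the sum of `f` over the sets disjoint from
    -- `Iᶜ`, among which only `I` is an `i`-set.
    have h1 : ∑ K ∈ Iᶜ.powerset, (-1 : ℂ) ^ K.card * downSum f K = 0 := by
      refine sum_eq_zero fun K hK => ?_
      have h2 := card_le_card (mem_powerset.mp hK)
      have h3 := card_add_card_compl I
      by_cases h4 : K.card ≤ i
      · rw [key K.card h4 (by omega) K rfl, mul_zero]
      · rw [downSum, sum_eq_zero, mul_zero]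
        intro J hJ
        have h5 := card_le_card (mem_filter.mp hJ).2
        exact hf J (by omega)
    rw [← h1]
    simp only [downSum, sum_filter, mul_sum]
    rw [sum_comm]
    have h2 : ∀ J : Finset V, ∑ K ∈ Iᶜ.powerset, (-1 : ℂ) ^ K.card * (if K ⊆ J then f J else 0) =
        if J ⊆ I then f J else 0 := fun J => by
      have h3 := congrArg (Int.cast : ℤ → ℂ) (sum_powerset_neg_one_pow_card (x := J \ I))
      push_cast at h3
      have h4 : ∑ K ∈ Iᶜ.powerset, (-1 : ℂ) ^ K.card * (if K ⊆ J then f J else 0) =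
          (∑ K ∈ (J \ I).powerset, (-1 : ℂ) ^ K.card) * f J := by
        simp only [mul_ite, mul_zero]
        rw [← sum_filter, sum_mul]
        refine sum_congr ?_ fun _ _ => rfl
        ext K
        rw [mem_filter, mem_powerset, mem_powerset, sdiff_eq_inter_compl, subset_inter_iff,
          and_comm]
      rw [h4, h3]
      simp [sdiff_eq_empty_iff_subset]
    rw [sum_congr rfl fun J _ => h2 J, sum_eq_single I]
    · simp
    · intro J _ hJ
      split_ifs with h
      · refine hf J fun h' => hJ (eq_of_subset_of_card_le h (by omega))
      · rfl
    · simp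
  · exact hf I hI

end Johnson

/-! ### Sets of positions containing a given set -/

section Outside

variable {n : ℕ} (A : Finset (Fin n))

/-- The trace of a set of positions on the complement of `A`. -/
def outside (X : Finset (Fin n)) : Finset ↥Aᶜ := X.subtype (· ∈ Aᶜ)

/-- The union of `A` with a subset of the complement of `A`. -/
def adjoin (Z : Finset ↥Aᶜ) : Finset (Fin n) := A ∪ Z.map (Function.Embedding.subtype _)

theorem subset_adjoin (Z : Finset ↥Aᶜ) : A ⊆ adjoin A Z := subset_union_left

theorem outside_adjoin (Z : Finset ↥Aᶜ) : outside A (adjoin A Z) = Z := by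
  ext ⟨x, hx⟩
  have hx' := mem_compl.mp hx
  simp [outside, adjoin, hx']

theorem adjoin_outside {X : Finset (Fin n)} (hX : A ⊆ X) : adjoin A (outside A X) = X := by
  ext x
  by_cases hx : x ∈ A
  · simp [adjoin, hx, hX hx]
  · simp [outside, adjoin, hx]

theorem card_outside {X : Finset (Fin n)} (hX : A ⊆ X) :
    (outside A X).card = X.card - A.card := by
  conv_rhs => rw [← adjoin_outside A hX]
  have hd : Disjoint A ((outside A X).map (Function.Embedding.subtype _)) := by
    rw [disjoint_left]
    intro x hx hx'
    obtain ⟨y, -, rfl⟩ := mem_map.mp hx'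
    exact mem_compl.mp y.2 hx
  rw [adjoin, card_union_of_disjoint hd, card_map]
  omega

theorem outside_inter (X Y : Finset (Fin n)) :
    outside A (X ∩ Y) = outside A X ∩ outside A Y := by
  ext; simp [outside]

theorem card_coe_compl : Fintype.card ↥Aᶜ = n - A.card := by
  rw [Fintype.card_coe, card_compl, Fintype.card_fin]

theorem sum_superset (F : Finset (Fin n) → ℂ) :
    ∑ X with A ⊆ X, F X = ∑ Z, F (adjoin A Z) :=
  sum_nbij' (outside A) (adjoin A) (fun _ _ => mem_univ _)
    (fun Z _ => mem_filter.mpr ⟨mem_univ _, subset_adjoin A Z⟩)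
    (fun _ hX => adjoin_outside A (mem_filter.mp hX).2) (fun Z _ => outside_adjoin A Z)
    (fun X hX => by rw [adjoin_outside A (mem_filter.mp hX).2])

end Outside

/-! ### Characters on the words of a given support -/

section Characters

variable {n q : ℕ}

theorem sum_supp_eq {R : Type*} [CommSemiring R] (Y : Finset (Fin n)) (g : Fin n → Fin q → R) :
    ∑ x : Word n q with supp x = Y, ∏ h, g h (x h) =
      ∏ h, ∑ c ∈ univ.filter fun c : Fin q => ((c : ℕ) ≠ 0 ↔ h ∈ Y), g h c := by
  rw [prod_univ_sum]
  refine sum_congr ?_ fun _ _ => rfl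
  ext x
  simp [supp, Fintype.mem_piFinset, Finset.ext_iff]

theorem sum_ne_zero_eq_sum_range {R : Type*} [AddCommMonoid R] (hq : 2 ≤ q) (f : ℕ → R) :
    ∑ c ∈ univ.filter fun c : Fin q => (c : ℕ) ≠ 0, f c = ∑ x ∈ range (q - 1), f (x + 1) := by
  obtain ⟨r, rfl⟩ : ∃ r, q = r + 1 := ⟨q - 1, by omega⟩
  rw [sum_filter, Fin.sum_univ_succ]
  simp [sum_range]

theorem sum_ne_last_eq_sum_range {R : Type*} [AddCommMonoid R] (hq : 2 ≤ q) (f : ℕ → R) :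
    ∑ c ∈ univ.filter fun c : Fin q => (c : ℕ) ≠ q - 1, f c = ∑ x ∈ range (q - 1), f x := by
  obtain ⟨r, rfl⟩ : ∃ r, q = r + 1 := ⟨q - 1, by omega⟩
  rw [sum_filter, Fin.sum_univ_castSucc]
  simp [sum_range, fun x : Fin r => x.2.ne]

theorem sum_range_root {N : ℕ} {ζ : ℂ} (hζ : ζ ^ N = 1) :
    ∑ x ∈ range N, ζ ^ x = if ζ = 1 then (N : ℂ) else 0 := by
  split_ifs with h
  · simp [h]
  · rw [geom_sum_eq h, hζ, sub_self, zero_div]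

theorem sum_ne_zero_root (hq : 2 ≤ q) {ζ : ℂ} (hζ : ζ ^ (q - 1) = 1) :
    ∑ c ∈ univ.filter fun c : Fin q => (c : ℕ) ≠ 0, ζ ^ (c : ℕ) = if ζ = 1 then (q : ℂ) - 1 else 0 := by
  rw [sum_ne_zero_eq_sum_range hq (fun x => ζ ^ x)]
  simp only [pow_succ]
  rw [← sum_mul, sum_range_root hζ]
  split_ifs with h
  · rw [h, mul_one]; push_cast [show 1 ≤ q by omega]; rfl
  · rw [zero_mul]

theorem sum_ne_last_root (hq : 2 ≤ q) {ζ : ℂ} (hζ : ζ ^ (q - 1) = 1) :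
    ∑ c ∈ univ.filter fun c : Fin q => (c : ℕ) ≠ q - 1, ζ ^ (c : ℕ) = if ζ = 1 then (q : ℂ) - 1 else 0 := by
  rw [sum_ne_last_eq_sum_range hq (fun x => ζ ^ x), sum_range_root hζ]
  push_cast [show 1 ≤ q by omega]; rfl

variable {φ : ℂ}

theorem conj_mul_self_of_root (hq : 2 ≤ q) (hφ : IsPrimitiveRoot φ (q - 1)) :
    conj φ * φ = 1 := by
  have h : ‖φ‖ = 1 := hφ.norm'_eq_one (by omega)
  rw [mul_comm, Complex.mul_conj, Complex.normSq_eq_norm_sq, h]; simp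

theorem conj_pow_mul_pow_eq_one_iff (hq : 2 ≤ q) (hφ : IsPrimitiveRoot φ (q - 1)) {c d : ℕ} :
    conj φ ^ c * φ ^ d = 1 ↔ φ ^ c = φ ^ d := by
  have h0 : conj φ ^ c * φ ^ c = 1 := by rw [← mul_pow, conj_mul_self_of_root hq hφ, one_pow]
  constructor
  · intro h
    have h1 := congrArg (φ ^ c * ·) h
    simp only [mul_one] at h1
    rw [← h1, ← mul_assoc, mul_comm (φ ^ c), h0, one_mul]
  · intro h
    rw [← h, h0]

theorem conj_pow_mul_pow_root (hφ : IsPrimitiveRoot φ (q - 1)) (c d : ℕ) :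
    (conj φ ^ c * φ ^ d) ^ (q - 1) = 1 := by
  rw [mul_pow, ← pow_mul, ← pow_mul, mul_comm c, mul_comm d, pow_mul, pow_mul, ← map_pow,
    hφ.pow_eq_one, map_one, one_pow, one_pow, mul_one]

theorem pow_pairing (w x : Word n q) :
    φ ^ pairing w x = ∏ h, (φ ^ (w h : ℕ)) ^ (x h : ℕ) := by
  simp only [pairing, ← pow_mul, prod_pow_eq_pow_sum]

theorem pairing_comm (w x : Word n q) : pairing w x = pairing x w :=
  sum_congr rfl fun _ _ => mul_comm _ _

theorem conj_pow_pairing_mul (w w' x : Word n q) :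
    conj (φ ^ pairing w x) * φ ^ pairing w' x =
      ∏ h, (conj φ ^ (w h : ℕ) * φ ^ (w' h : ℕ)) ^ (x h : ℕ) := by
  simp only [pow_pairing, map_prod, map_pow, ← prod_mul_distrib, ← mul_pow]

theorem notMem_supp {x : Word n q} {h : Fin n} : h ∉ supp x ↔ (x h : ℕ) = 0 := by
  simp [supp]

theorem mem_supp {x : Word n q} {h : Fin n} : h ∈ supp x ↔ (x h : ℕ) ≠ 0 := by
  simp [supp]

/-- Orthogonality of the characters indexed by two words without letter `q - 1` on the set of
words of support `X`. -/
theorem sum_conj_pairing (hq : 2 ≤ q) (hφ : IsPrimitiveRoot φ (q - 1)) {w w' : Word n q}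
    (hw : ∀ h, (w h : ℕ) ≠ q - 1) (hw' : ∀ h, (w' h : ℕ) ≠ q - 1) {X : Finset (Fin n)}
    (hX : supp w ⊆ X) (hX' : supp w' ⊆ X) :
    ∑ x : Word n q with supp x = X, conj (φ ^ pairing w x) * φ ^ pairing w' x =
      if w = w' then ((q : ℂ) - 1) ^ X.card else 0 := by
  simp only [conj_pow_pairing_mul]
  rw [sum_supp_eq X (fun h c => (conj φ ^ (w h : ℕ) * φ ^ (w' h : ℕ)) ^ (c : ℕ))]
  have h1 : ∀ h, ∑ c ∈ univ.filter fun c : Fin q => ((c : ℕ) ≠ 0 ↔ h ∈ X),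
      (conj φ ^ (w h : ℕ) * φ ^ (w' h : ℕ)) ^ (c : ℕ) =
        if h ∈ X then (if w h = w' h then (q : ℂ) - 1 else 0) else 1 := fun h => by
    by_cases hh : h ∈ X
    · simp only [hh, iff_true, if_true]
      rw [sum_ne_zero_root hq (conj_pow_mul_pow_root hφ _ _)]
      congr 1
      rw [conj_pow_mul_pow_eq_one_iff hq hφ, eq_iff_iff]
      constructor
      · intro h2
        have h3 := (w h).2
        have h4 := (w' h).2
        have h5 := hw h
        have h6 := hw' h
        exact Fin.ext (hφ.pow_inj (by omega) (by omega) h2)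
      · intro h2; rw [h2]
    · simp only [hh, iff_false, not_not, if_false]
      rw [sum_eq_single (⟨0, by omega⟩ : Fin q)]
      · simp
      · intro c hc hne
        exact absurd (Fin.ext (mem_filter.mp hc).2) hne
      · simp
  rw [prod_congr rfl fun h _ => h1 h]
  split_ifs with hww
  · simp [hww, prod_ite_mem]
  · obtain ⟨h, hh⟩ := Function.ne_iff.mp hww
    refine prod_eq_zero (mem_univ h) ?_
    have h2 : h ∈ X := by
      by_contra h3
      have h4 := notMem_supp.mp fun h5 => h3 (hX h5)
      have h6 := notMem_supp.mp fun h5 => h3 (hX' h5)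
      exact hh (Fin.ext (h4.trans h6.symm))
    rw [if_pos h2, if_neg hh]

/-- The dual orthogonality relation: a function on words of support `X` is determined by its
character sums. -/
theorem sum_pairing_conj (hq : 2 ≤ q) (hφ : IsPrimitiveRoot φ (q - 1)) (x y : Word n q)
    (hxy : supp x = supp y) :
    ∑ w : Word n q with supp w ⊆ supp y ∧ ∀ h, (w h : ℕ) ≠ q - 1,
        conj (φ ^ pairing w x) * φ ^ pairing w y =
      if x = y then ((q : ℂ) - 1) ^ (supp y).card else 0 := by
  have e : (univ.filter fun w : Word n q => supp w ⊆ supp y ∧ ∀ h, (w h : ℕ) ≠ q - 1) =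
      Fintype.piFinset fun h => univ.filter fun c : Fin q =>
        (h ∉ supp y → (c : ℕ) = 0) ∧ (c : ℕ) ≠ q - 1 := by
    ext w
    simp only [mem_filter, mem_univ, true_and, Fintype.mem_piFinset, forall_and]
    refine and_congr_left fun _ => ⟨fun h1 h h2 => notMem_supp.mp fun h3 => h2 (h1 h3),
      fun h1 h h2 => ?_⟩
    by_contra h3
    exact mem_supp.mp h2 (h1 h h3)
  simp only [fun w => pairing_comm (n := n) (q := q) w, conj_pow_pairing_mul]
  rw [e, ← prod_univ_sum _ (fun h (c : Fin q) => (conj φ ^ (x h : ℕ) * φ ^ (y h : ℕ)) ^ (c : ℕ))]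
  have h1 : ∀ h, ∑ c ∈ univ.filter fun c : Fin q =>
      (h ∉ supp y → (c : ℕ) = 0) ∧ (c : ℕ) ≠ q - 1,
      (conj φ ^ (x h : ℕ) * φ ^ (y h : ℕ)) ^ (c : ℕ) =
        if h ∈ supp y then (if x h = y h then (q : ℂ) - 1 else 0) else 1 := fun h => by
    by_cases hh : h ∈ supp y
    · simp only [hh, not_true, false_imp_iff, true_and, if_true]
      rw [sum_ne_last_root hq (conj_pow_mul_pow_root hφ _ _)]
      congr 1
      rw [conj_pow_mul_pow_eq_one_iff hq hφ, eq_iff_iff]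
      constructor
      · intro h2
        have h3 := (x h).2
        have h4 := (y h).2
        have h5 := mem_supp.mp hh
        have h6 := mem_supp.mp (hxy ▸ hh : h ∈ supp x)
        -- Both letters lie between `1` and `q - 1`, so the powers are shifted down by one.
        obtain ⟨c, hc⟩ : ∃ c, (x h : ℕ) = c + 1 := ⟨(x h : ℕ) - 1, by omega⟩
        obtain ⟨d, hd⟩ : ∃ d, (y h : ℕ) = d + 1 := ⟨(y h : ℕ) - 1, by omega⟩
        rw [hc, hd, pow_succ, pow_succ] at h2
        have h7 := hφ.pow_inj (by omega) (by omega)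
          (mul_right_cancel₀ (hφ.ne_zero (by omega)) h2)
        exact Fin.ext (by omega)
      · intro h2; rw [h2]
    · simp only [hh, not_false_iff, true_imp_iff, if_false]
      rw [sum_eq_single (⟨0, by omega⟩ : Fin q)]
      · simp
      · intro c hc hne
        exact absurd (Fin.ext (mem_filter.mp hc).2.1) hne
      · intro h2
        exact absurd (mem_filter.mpr ⟨mem_univ _, rfl, by simp; omega⟩) h2
  rw [prod_congr rfl fun h _ => h1 h]
  split_ifs with hww
  · simp [hww, prod_ite_mem]
  · obtain ⟨h, hh⟩ := Function.ne_iff.mp hww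
    refine prod_eq_zero (mem_univ h) ?_
    have h2 : h ∈ supp y := by
      by_contra h3
      have h4 := notMem_supp.mp h3
      have h6 := notMem_supp.mp (hxy ▸ h3 : h ∉ supp x)
      exact hh (Fin.ext (h6.trans h4.symm))
    rw [if_pos h2, if_neg hh]

end Characters

/-! ### Character sums over words with prescribed agreement -/

section Agreement

variable {n q : ℕ} {φ : ℂ}

/-- The positions at which `u` and `v` carry the same nonzero letter. -/
def agreement (u v : Word n q) : Finset (Fin n) :=
  univ.filter fun h => v h = u h ∧ (u h : ℕ) ≠ 0

theorem root_pow_eq_one_iff (hφ : IsPrimitiveRoot φ (q - 1)) {w : Word n q}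
    (hw : ∀ h, (w h : ℕ) ≠ q - 1) (h : Fin n) : φ ^ (w h : ℕ) = 1 ↔ (w h : ℕ) = 0 := by
  rw [hφ.pow_eq_one_iff_dvd]
  constructor
  · intro h1
    have h2 := hw h
    have h3 := (w h).2
    exact Nat.eq_zero_of_dvd_of_lt h1 (by omega)
  · intro h1; rw [h1]; exact dvd_zero _

open Polynomial in
/-- The agreement enumerator of the words of support `Y`, weighted by a character, is a product
over the positions. -/
theorem sum_agreement_X_pow (hq : 2 ≤ q) (hφ : IsPrimitiveRoot φ (q - 1)) {w : Word n q}
    (hw : ∀ h, (w h : ℕ) ≠ q - 1) (u : Word n q) {Y : Finset (Fin n)} (hY : supp w ⊆ Y) :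
    ∑ v : Word n q with supp v = Y,
        Polynomial.C (φ ^ pairing w v) * X ^ (agreement u v).card =
      if supp w ⊆ supp u then
        Polynomial.C (φ ^ pairing w u * ((q : ℂ) - 1) ^ (Y \ supp u).card) *
          ((X - 1) ^ (supp w).card *
            (X + Polynomial.C ((q : ℂ) - 2)) ^ ((supp u ∩ Y) \ supp w).card)
      else 0 := by
  set g : Fin n → Fin q → ℂ[X] := fun h c => Polynomial.C ((φ ^ (w h : ℕ)) ^ (c : ℕ)) *
    (if c = u h ∧ (u h : ℕ) ≠ 0 then X else 1) with hg
  have h1 : ∀ v : Word n q, Polynomial.C (φ ^ pairing w v) * X ^ (agreement u v).card =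
      ∏ h, g h (v h) := fun v => by
    simp only [hg]
    rw [prod_mul_distrib, pow_pairing, map_prod, prod_ite, prod_const_one, mul_one, prod_const]
    rfl
  have hroot : ∀ h, ∑ c ∈ univ.filter fun c : Fin q => (c : ℕ) ≠ 0,
      (φ ^ (w h : ℕ)) ^ (c : ℕ) = if (w h : ℕ) = 0 then (q : ℂ) - 1 else 0 := fun h => by
    rw [sum_ne_zero_root hq (by rw [← pow_mul, mul_comm, pow_mul, hφ.pow_eq_one, one_pow])]
    simp only [root_pow_eq_one_iff hφ hw]
  -- The factors at the positions outside `Y`, in `Y \ supp u`, and in `Y ∩ supp u`.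
  have f1 : ∀ h, h ∉ Y →
      ∑ c ∈ univ.filter fun c : Fin q => ((c : ℕ) ≠ 0 ↔ h ∈ Y), g h c = 1 := fun h hh => by
    simp only [hh, iff_false, not_not]
    rw [sum_eq_single (⟨0, by omega⟩ : Fin q)]
    · simp only [hg]
      rw [if_neg]
      · simp
      · rintro ⟨h2, h3⟩
        exact h3 (by rw [← h2])
    · intro c hc hne
      exact absurd (Fin.ext (mem_filter.mp hc).2) hne
    · simp
  have f2 : ∀ h, h ∈ Y → (u h : ℕ) = 0 →
      ∑ c ∈ univ.filter fun c : Fin q => ((c : ℕ) ≠ 0 ↔ h ∈ Y), g h c =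
        if (w h : ℕ) = 0 then Polynomial.C ((q : ℂ) - 1) else 0 := fun h hh hu => by
    simp only [hh, iff_true, hg, hu, ne_eq, not_true, and_false, if_false, mul_one]
    rw [← map_sum, hroot]
    split_ifs <;> simp
  have f3 : ∀ h, h ∈ Y → (u h : ℕ) ≠ 0 →
      ∑ c ∈ univ.filter fun c : Fin q => ((c : ℕ) ≠ 0 ↔ h ∈ Y), g h c =
        Polynomial.C (if (w h : ℕ) = 0 then (q : ℂ) - 1 else 0) +
          Polynomial.C ((φ ^ (w h : ℕ)) ^ (u h : ℕ)) * (X - 1) := fun h hh hu => by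
    have h2 : ∀ c, g h c = Polynomial.C ((φ ^ (w h : ℕ)) ^ (c : ℕ)) +
        (if c = u h then Polynomial.C ((φ ^ (w h : ℕ)) ^ (c : ℕ)) * (X - 1) else 0) := fun c => by
      simp only [hg, hu, ne_eq, not_false_iff, and_true]
      split_ifs <;> ring
    rw [sum_congr rfl fun c _ => h2 c, sum_add_distrib]
    simp only [hh, iff_true]
    rw [← map_sum, hroot, sum_ite_eq',
      if_pos (show u h ∈ univ.filter fun c : Fin q => (c : ℕ) ≠ 0 from
        mem_filter.mpr ⟨mem_univ _, hu⟩)]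
  rw [sum_congr rfl fun v _ => h1 v, sum_supp_eq]
  split_ifs with hwu
  · have h3 : ∀ h, ∑ c ∈ univ.filter fun c : Fin q => ((c : ℕ) ≠ 0 ↔ h ∈ Y), g h c =
        Polynomial.C ((φ ^ (w h : ℕ)) ^ (u h : ℕ)) *
          (if h ∈ Y \ supp u then Polynomial.C ((q : ℂ) - 1) else 1) *
          ((if h ∈ supp w then X - 1 else 1) *
            (if h ∈ (supp u ∩ Y) \ supp w then X + Polynomial.C ((q : ℂ) - 2) else 1)) :=
        fun h => by
      by_cases hA : h ∈ supp w
      · have hU := hwu hA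
        have hh := hY hA
        rw [f3 h hh (mem_supp.mp hU)]
        simp [hA, hU, mem_supp.mp hA]
      · have hw0 := notMem_supp.mp hA
        by_cases hh : h ∈ Y
        · by_cases hU : h ∈ supp u
          · rw [f3 h hh (mem_supp.mp hU)]
            simp only [hw0, hA, hU, hh, mem_sdiff, mem_inter, if_true, if_false, pow_zero,
              one_pow, not_true, not_false_iff, and_true, and_false, map_one, map_sub, map_ofNat]
            ring
          · rw [f2 h hh (notMem_supp.mp hU)]
            simp [hw0, hA, hU, hh]
        · rw [f1 h hh]
          simp [hw0, hA, hh]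
    rw [prod_congr rfl fun h _ => h3 h]
    simp only [prod_mul_distrib, prod_ite_mem, univ_inter, prod_const, pow_pairing, map_mul,
      map_prod, map_pow]
  · obtain ⟨h, hA, hU⟩ := not_subset.mp hwu
    refine prod_eq_zero (mem_univ h) ?_
    rw [f2 h (hY hA) (notMem_supp.mp hU), if_neg (mem_supp.mp hA)]

/-- The sum occurring in `alpha`. For `a ≤ t` it is the coefficient of `X ^ p` in
`(X - 1) ^ a * (X + q - 2) ^ (t - a)`. -/
noncomputable def agreementCoeff (q t p a : ℕ) : ℝ :=
  ∑ g ∈ Finset.range (p + 1), (-1 : ℝ) ^ ((a : ℤ) - g) * (binom a g : ℝ) *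
    (binom ((t : ℤ) - a) ((p : ℤ) - g) : ℝ) * ((q : ℝ) - 2) ^ ((t : ℤ) - a - p + g)

theorem coeff_eq_agreementCoeff (q p : ℕ) {a t : ℕ} (hat : a ≤ t) :
    ((Polynomial.X - 1 : Polynomial ℂ) ^ a *
      (Polynomial.X + Polynomial.C ((q : ℂ) - 2)) ^ (t - a)).coeff p =
        (agreementCoeff q t p a : ℂ) := by
  have e : (Polynomial.X - 1 : Polynomial ℂ) = Polynomial.X + Polynomial.C (-1) := by
    simp [sub_eq_add_neg]
  rw [Polynomial.coeff_mul, Finset.Nat.sum_antidiagonal_eq_sum_range_succ_mk, agreementCoeff,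
    Complex.ofReal_sum]
  refine sum_congr rfl fun g hg => ?_
  have hgp : g ≤ p := Nat.lt_succ_iff.mp (mem_range.mp hg)
  simp only [e, Polynomial.coeff_X_add_C_pow]
  by_cases h1 : g ≤ a
  · by_cases h2 : p - g ≤ t - a
    · have e1 : (a : ℤ) - g = ((a - g : ℕ) : ℤ) := by omega
      have e2 : (t : ℤ) - a - p + g = ((t - a - (p - g) : ℕ) : ℤ) := by omega
      have e3 : binom (a : ℤ) g = a.choose g := by rw [binom, if_pos (by omega)]; simp
      have e4 : binom ((t : ℤ) - a) ((p : ℤ) - g) = (t - a).choose (p - g) := by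
        rw [binom, if_pos (by omega)]; congr 1 <;> omega
      rw [e1, e2, e3, e4, zpow_natCast, zpow_natCast]
      push_cast
      ring
    · rw [Nat.choose_eq_zero_of_lt (show t - a < p - g by omega),
        show binom ((t : ℤ) - a) ((p : ℤ) - g) = 0 from if_neg (by omega)]
      simp
  · rw [Nat.choose_eq_zero_of_lt (show a < g by omega),
      show binom (a : ℤ) g = 0 from if_neg (by omega)]
    simp

theorem sum_agreement_card_eq (hq : 2 ≤ q) (hφ : IsPrimitiveRoot φ (q - 1)) {w : Word n q}
    (hw : ∀ h, (w h : ℕ) ≠ q - 1) (u : Word n q) {Y : Finset (Fin n)} (hY : supp w ⊆ Y)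
    {t : ℕ} (ht : (supp u ∩ Y).card = t) (p : ℕ) :
    ∑ v : Word n q with supp v = Y ∧ (agreement u v).card = p, φ ^ pairing w v =
      if supp w ⊆ supp u then
        φ ^ pairing w u * ((q : ℂ) - 1) ^ (Y.card - t) * agreementCoeff q t p (supp w).card
      else 0 := by
  have h := congrArg (fun P => Polynomial.coeff P p) (sum_agreement_X_pow hq hφ hw u hY)
  simp only [Polynomial.finsetSum_coeff, Polynomial.coeff_C_mul, Polynomial.coeff_X_pow] at h
  rw [← filter_filter, sum_filter]
  refine Eq.trans (sum_congr rfl fun v _ => ?_) (h.trans ?_)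
  · by_cases h : (agreement u v).card = p
    · simp [h]
    · simp [h, Ne.symm h]
  · split_ifs with hwu
    · have hwt : supp w ⊆ supp u ∩ Y := subset_inter hwu hY
      have h2 := card_inter_add_card_sdiff Y (supp u)
      rw [inter_comm] at h2
      rw [card_sdiff_of_subset hwt, ht, Polynomial.coeff_C_mul,
        coeff_eq_agreementCoeff q p (ht ▸ card_le_card hwt),
        show (Y \ supp u).card = Y.card - t by omega]
    · simp

end Agreement

/-! ### The vectors `Psi` -/

section Psi

variable {n q : ℕ} {φ : ℂ}

/-- The factor normalizing the vectors `Psi`. -/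
noncomputable def normCoeff (n q a k i : ℕ) : ℝ :=
  ((q : ℝ) - 1) ^ (-(i : ℝ) / 2) *
    (binom ((n : ℤ) + a - 2 * k) ((i : ℤ) - k) : ℝ) ^ (-(1 / 2) : ℝ)

theorem rpow_neg_half_mul_self {x : ℝ} (hx : 0 < x) :
    x ^ (-(1 / 2) : ℝ) * x ^ (-(1 / 2) : ℝ) * x = 1 := by
  nth_rewrite 3 [← Real.rpow_one x]
  rw [← Real.rpow_add hx, ← Real.rpow_add hx]
  norm_num

theorem binom_pos {r s : ℤ} (h0 : 0 ≤ s) (h1 : s ≤ r) : 0 < binom r s := by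
  rw [binom, if_pos ⟨h0, h1⟩]
  exact Nat.choose_pos (by omega)

theorem normCoeff_mul_self {a k i : ℕ} (hq : 2 ≤ q) (hki : k ≤ i) (hi : i + k ≤ n + a) :
    normCoeff n q a k i * normCoeff n q a k i * ((q : ℝ) - 1) ^ i *
      binom ((n : ℤ) + a - 2 * k) ((i : ℤ) - k) = 1 := by
  have hq' : (0 : ℝ) < (q : ℝ) - 1 := by
    have : (2 : ℝ) ≤ q := by exact_mod_cast hq
    linarith
  have h1 : (0 : ℝ) < (binom ((n : ℤ) + a - 2 * k) ((i : ℤ) - k) : ℝ) :=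
    Nat.cast_pos.mpr (binom_pos (by omega) (by omega))
  have h2 := rpow_neg_half_mul_self h1
  have h3 : ((q : ℝ) - 1) ^ (-(i : ℝ) / 2) * ((q : ℝ) - 1) ^ (-(i : ℝ) / 2) * ((q : ℝ) - 1) ^ i
      = 1 := by
    rw [← Real.rpow_natCast, ← Real.rpow_add hq', ← Real.rpow_add hq']
    ring_nf
    exact Real.rpow_zero _
  unfold normCoeff
  linear_combination ((q : ℝ) - 1) ^ (-(i : ℝ) / 2) * ((q : ℝ) - 1) ^ (-(i : ℝ) / 2) *
    ((q : ℝ) - 1) ^ i * h2 + h3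

/-- The vector `Psi` lives on the words of weight `i` whose support contains that of `w`. -/
theorem Psi_apply {a k i : ℕ} {w : Word n q} {b : EuclideanSpace ℂ (Finset ↥(supp w)ᶜ)}
    (ha : (supp w).card = a) (hak : a ≤ k) (hki : k ≤ i) (hb : IsHarmonic (k - a) b.ofLp)
    (x : Word n q) :
    Psi φ a k i w b x = if supp w ⊆ supp x ∧ (supp x).card = i then
      normCoeff n q a k i * φ ^ pairing w x * upSum b.ofLp (outside (supp w) (supp x)) else 0 := by
  show (if supp w ⊆ supp x then _ else _) = _
  rw [C_mulVec_of_le b.ofLp (by omega) fun I hI => hb.eq_zero I (by omega)]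
  by_cases h1 : supp w ⊆ supp x
  · have h2 : (((outside (supp w) (supp x)).card : ℤ) = (i : ℤ) - a) ↔ (supp x).card = i := by
      have := card_le_card h1
      rw [card_outside _ h1]; omega
    change (if supp w ⊆ supp x then _ * _ *
      (if ((outside (supp w) (supp x)).card : ℤ) = (i : ℤ) - a then _ else 0) else 0) = _
    simp only [h1, h2, if_true, true_and, mul_ite, mul_zero]
    rfl
  · simp [h1]

theorem card_adjoin (A : Finset (Fin n)) (Z : Finset ↥Aᶜ) :
    (adjoin A Z).card = Z.card + A.card := by
  have h1 := card_outside A (subset_adjoin A Z)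
  have h2 := card_le_card (subset_adjoin A Z)
  rw [outside_adjoin] at h1
  omega

/-- The inner product with a vector `Psi`, with the words grouped by support. -/
theorem inner_Psi_left {a k i : ℕ} {w : Word n q} {b : EuclideanSpace ℂ (Finset ↥(supp w)ᶜ)}
    (ha : (supp w).card = a) (hak : a ≤ k) (hki : k ≤ i) (hb : IsHarmonic (k - a) b.ofLp)
    (f : EuclideanSpace ℂ (Word n q)) :
    inner ℂ (Psi φ a k i w b) f = normCoeff n q a k i * ∑ Z with Z.card = i - a,
      conj (upSum b.ofLp Z) *
        ∑ x : Word n q with supp x = adjoin (supp w) Z, conj (φ ^ pairing w x) * f x := by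
  rw [PiLp.inner_apply, ← sum_fiberwise univ supp]
  have h1 : ∀ X : Finset (Fin n),
      ∑ x : Word n q with supp x = X, inner ℂ (Psi φ a k i w b x) (f x) =
        if supp w ⊆ X then (if X.card = i then normCoeff n q a k i *
          (conj (upSum b.ofLp (outside (supp w) X)) *
            ∑ x : Word n q with supp x = X, conj (φ ^ pairing w x) * f x) else 0) else 0 :=
      fun X => by
    rw [← ite_and, mul_sum, mul_sum]
    split_ifs with h
    · refine sum_congr rfl fun x hx => ?_
      have hx := (mem_filter.mp hx).2
      rw [Psi_apply ha hak hki hb, hx, if_pos h, RCLike.inner_apply, map_mul, map_mul,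
        Complex.conj_ofReal]
      ring
    · refine sum_eq_zero fun x hx => ?_
      have hx := (mem_filter.mp hx).2
      rw [Psi_apply ha hak hki hb, hx, if_neg h, inner_zero_left]
  rw [sum_congr rfl fun X _ => h1 X, ← sum_filter, sum_superset, mul_sum, sum_filter]
  refine sum_congr rfl fun Z _ => ?_
  rw [card_adjoin, outside_adjoin]
  congr 1
  rw [eq_iff_iff]
  omega

theorem inner_Psi_Psi (hq : 2 ≤ q) (hφ : IsPrimitiveRoot φ (q - 1))
    {a k i a' k' i' : ℕ} {w w' : Word n q}
    {b : EuclideanSpace ℂ (Finset ↥(supp w)ᶜ)} {b' : EuclideanSpace ℂ (Finset ↥(supp w')ᶜ)}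
    (hw : ∀ h, (w h : ℕ) ≠ q - 1) (hw' : ∀ h, (w' h : ℕ) ≠ q - 1)
    (ha : (supp w).card = a) (hak : a ≤ k) (hki : k ≤ i) (hb : IsHarmonic (k - a) b.ofLp)
    (ha' : (supp w').card = a') (hak' : a' ≤ k') (hki' : k' ≤ i')
    (hb' : IsHarmonic (k' - a') b'.ofLp) :
    inner ℂ (Psi φ a k i w b) (Psi φ a' k' i' w' b') =
      if w = w' ∧ i = i' then normCoeff n q a k i * normCoeff n q a' k' i' * ((q : ℂ) - 1) ^ i *
        ∑ Z with Z.card = i - a, conj (upSum b.ofLp Z) *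
          upSum b'.ofLp (outside (supp w') (adjoin (supp w) Z)) else 0 := by
  rw [inner_Psi_left ha hak hki hb]
  have h1 : ∀ Z ∈ univ.filter (fun Z : Finset ↥(supp w)ᶜ => Z.card = i - a),
      conj (upSum b.ofLp Z) * ∑ x : Word n q with supp x = adjoin (supp w) Z,
        conj (φ ^ pairing w x) * Psi φ a' k' i' w' b' x =
      if w = w' ∧ i = i' then normCoeff n q a' k' i' * ((q : ℂ) - 1) ^ i *
        (conj (upSum b.ofLp Z) * upSum b'.ofLp (outside (supp w') (adjoin (supp w) Z))) else 0 := by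
    intro Z hZ
    have hc : (adjoin (supp w) Z).card = i := by
      rw [card_adjoin, (mem_filter.mp hZ).2]; omega
    by_cases h2 : supp w' ⊆ adjoin (supp w) Z ∧ i = i'
    · have h3 : ∑ x : Word n q with supp x = adjoin (supp w) Z,
          conj (φ ^ pairing w x) * Psi φ a' k' i' w' b' x =
          normCoeff n q a' k' i' * upSum b'.ofLp (outside (supp w') (adjoin (supp w) Z)) *
          ∑ x : Word n q with supp x = adjoin (supp w) Z,
            conj (φ ^ pairing w x) * φ ^ pairing w' x := by
        rw [mul_sum]
        refine sum_congr rfl fun x hx => ?_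
        rw [Psi_apply ha' hak' hki' hb', (mem_filter.mp hx).2, hc, if_pos h2]
        ring
      rw [h3, sum_conj_pairing hq hφ hw hw' (subset_adjoin _ _) h2.1, hc]
      simp only [h2.2, and_true]
      split_ifs <;> ring
    · rw [sum_eq_zero, mul_zero, if_neg]
      · rintro ⟨rfl, rfl⟩
        exact h2 ⟨subset_adjoin _ _, rfl⟩
      · intro x hx
        rw [Psi_apply ha' hak' hki' hb', (mem_filter.mp hx).2, hc, if_neg h2, mul_zero]
  rw [sum_congr rfl h1]
  split_ifs
  · rw [← mul_sum]; ring
  · simp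

/-- With the words grouped by support, the sum over the letters is `sum_agreement_card_eq` and the
remaining sum over the supports is `IsHarmonic.sum_upSum` on the complement of the support of
`w`. -/
theorem M_Psi_apply (hq : 2 ≤ q) (hφ : IsPrimitiveRoot φ (q - 1)) {a k i j t p : ℕ}
    {w : Word n q} {b : EuclideanSpace ℂ (Finset ↥(supp w)ᶜ)}
    (hw : ∀ h, (w h : ℕ) ≠ q - 1) (ha : (supp w).card = a) (hak : a ≤ k) (hki : k ≤ i)
    (hb : IsHarmonic (k - a) b.ofLp) (hti : t ≤ i) (u : Word n q) :
    Matrix.toEuclideanLin (M n q j i t p) (Psi φ a k i w b) u =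
      if supp w ⊆ supp u ∧ (supp u).card = j ∧ a ≤ t then
        normCoeff n q a k i *
          (φ ^ pairing w u * ((q : ℂ) - 1) ^ (i - t) * agreementCoeff q t p a) *
          (layerCoeff (n - a) (t - a : ℕ) (j - a : ℕ) (i - a : ℕ) (k - a : ℕ) *
            upSum b.ofLp (outside (supp w) (supp u))) else 0 := by
  have h0 : Matrix.toEuclideanLin (M n q j i t p) (Psi φ a k i w b) u =
      ∑ v, M n q j i t p u v * Psi φ a k i w b v := rfl
  rw [h0, ← sum_fiberwise univ supp]
  have h1 : ∀ Y : Finset (Fin n),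
      ∑ v : Word n q with supp v = Y, M n q j i t p u v * Psi φ a k i w b v =
      if supp w ⊆ Y then
        (if Y.card = i ∧ (supp u ∩ Y).card = t then
          (if supp w ⊆ supp u ∧ (supp u).card = j ∧ a ≤ t then normCoeff n q a k i *
            (φ ^ pairing w u * ((q : ℂ) - 1) ^ (i - t) * agreementCoeff q t p a) *
            upSum b.ofLp (outside (supp w) Y) else 0) else 0) else 0 := by
    intro Y
    by_cases hA : supp w ⊆ Y
    swap
    · rw [if_neg hA, sum_eq_zero]
      intro v hv
      rw [Psi_apply ha hak hki hb, (mem_filter.mp hv).2, if_neg fun h => hA h.1, mul_zero]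
    rw [if_pos hA]
    by_cases hY : Y.card = i ∧ (supp u ∩ Y).card = t
    swap
    · rw [if_neg hY, sum_eq_zero]
      intro v hv
      rw [M, Matrix.of_apply, (mem_filter.mp hv).2, if_neg fun h => hY ⟨h.2.1, h.2.2.1⟩, zero_mul]
    rw [if_pos hY]
    have h2 : ∑ v : Word n q with supp v = Y, M n q j i t p u v * Psi φ a k i w b v =
        if (supp u).card = j then normCoeff n q a k i * upSum b.ofLp (outside (supp w) Y) *
          ∑ v : Word n q with supp v = Y ∧ (agreement u v).card = p, φ ^ pairing w v else 0 := by
      rw [← filter_filter, sum_filter (fun v => (agreement u v).card = p), mul_sum]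
      split_ifs with hj
      · refine sum_congr rfl fun v hv => ?_
        have hv := (mem_filter.mp hv).2
        rw [Psi_apply ha hak hki hb, hv, if_pos ⟨hA, hY.1⟩, M, Matrix.of_apply, hv]
        change (if _ ∧ _ ∧ _ ∧ (agreement u v).card = p then (1 : ℂ) else 0) * _ = _
        simp only [hj, hY, true_and]
        split_ifs <;> ring
      · refine sum_eq_zero fun v _ => ?_
        rw [M, Matrix.of_apply, if_neg fun h => hj h.1, zero_mul]
    rw [h2, sum_agreement_card_eq hq hφ hw u hA hY.2, hY.1, ha]
    have h3 : supp w ⊆ supp u → a ≤ t := fun h => by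
      rw [← ha, ← hY.2]; exact card_le_card (subset_inter h hA)
    by_cases h4 : supp w ⊆ supp u
    · by_cases h5 : (supp u).card = j
      · rw [if_pos h5, if_pos h4, if_pos ⟨h4, h5, h3 h4⟩]; ring
      · rw [if_neg h5, if_neg fun h => h5 h.2.1]
    · simp only [h4, false_and, if_false, mul_zero, ite_self]
  rw [sum_congr rfl fun Y _ => h1 Y, ← sum_filter, sum_superset]
  by_cases h : supp w ⊆ supp u ∧ (supp u).card = j ∧ a ≤ t
  · obtain ⟨hA, hj, hat⟩ := h
    have h4 : ∀ Z : Finset ↥(supp w)ᶜ,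
        ((adjoin (supp w) Z).card = i ∧ (supp u ∩ adjoin (supp w) Z).card = t) ↔
          (Z.card = i - a ∧ (Z ∩ outside (supp w) (supp u)).card = t - a) := fun Z => by
      have h5 : (Z ∩ outside (supp w) (supp u)).card = (supp u ∩ adjoin (supp w) Z).card - a := by
        rw [← ha, ← card_outside _ (subset_inter hA (subset_adjoin _ Z)), outside_inter,
          outside_adjoin, inter_comm]
      have h6 := card_le_card (subset_inter hA (subset_adjoin _ Z))
      rw [card_adjoin, h5]
      omega
    have h7 := hb.sum_upSum (outside (supp w) (supp u)) (Nat.sub_le_sub_right hti a)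
    rw [card_outside _ hA, card_coe_compl, ha, hj] at h7
    rw [if_pos ⟨hA, hj, hat⟩, ← h7, mul_sum, sum_filter]
    refine sum_congr rfl fun Z _ => ?_
    simp only [h4, outside_adjoin, hA, hj, hat, and_self, if_true]
  · simp [h]

end Psi

/-! ### The orthonormal basis and the action on it -/

section Basis

variable {n q : ℕ} {φ : ℂ} {B : BaseFamily n}

theorem Index.a_le (v : Index n q B) : v.a ≤ n := by
  rw [← v.card_supp]
  exact (card_le_univ _).trans_eq (Fintype.card_fin n)

theorem Index.isOrthonormalBase (hB : B.IsAdmissible) (v : Index n q B) :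
    IsOrthonormalBase (B (supp v.w)ᶜ (v.k - v.a)) (L ↥(supp v.w)ᶜ (v.k - v.a)) := by
  refine hB _ _ ?_
  have h1 := v.i_le
  have h2 := v.k_le_i
  have h3 := v.a_le
  have h4 := v.a_le_k
  rw [card_compl, Fintype.card_fin, v.card_supp]
  omega

theorem Index.isHarmonic (hB : B.IsAdmissible) (v : Index n q B) :
    IsHarmonic (v.k - v.a) v.b.ofLp := by
  rw [← mem_L_iff, ← (v.isOrthonormalBase hB).2]
  exact Submodule.subset_span v.b_mem

theorem Index.sum_conj_mul_self (hB : B.IsAdmissible) (v : Index n q B) :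
    ∑ I, conj (v.b.ofLp I) * v.b.ofLp I = 1 := by
  have h1 := (v.isOrthonormalBase hB).1.1 ⟨v.b, v.b_mem⟩
  have h2 := inner_self_eq_norm_sq_to_K (𝕜 := ℂ) v.b
  rw [show ‖v.b‖ = 1 from h1, PiLp.inner_apply] at h2
  simp only [RCLike.inner_apply, mul_comm (v.b.ofLp _)] at h2
  rw [h2]
  simp

theorem binom_sub_eq {a k i : ℕ} (han : a ≤ n) (hak : a ≤ k) (hki : k ≤ i) :
    binom (((n - a : ℕ) : ℤ) - 2 * (k - a : ℕ)) (((i - a : ℕ) : ℤ) - (k - a : ℕ)) =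
      binom ((n : ℤ) + a - 2 * k) ((i : ℤ) - k) := by
  congr 1 <;> omega

theorem orthonormal_Psi (hq : 2 ≤ q) (hφ : IsPrimitiveRoot φ (q - 1)) (hB : B.IsAdmissible) :
    Orthonormal ℂ (fun v : Index n q B => Psi φ v.a v.k v.i v.w v.b) := by
  classical
  rw [orthonormal_iff_ite]
  intro v v'
  rw [inner_Psi_Psi hq hφ v.letter_ne v'.letter_ne v.card_supp v.a_le_k v.k_le_i
    (v.isHarmonic hB) v'.card_supp v'.a_le_k v'.k_le_i (v'.isHarmonic hB)]
  by_cases h : v.w = v'.w ∧ v.i = v'.i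
  swap
  · rw [if_neg h, if_neg]
    rintro rfl
    exact h ⟨rfl, rfl⟩
  have hv := v.isHarmonic hB
  have hv' := v'.isHarmonic hB
  have hba := v.isOrthonormalBase hB
  have hn := v.sum_conj_mul_self hB
  have han := v.a_le
  obtain ⟨a, k, i, w, b, hak, hki, hi, hw, hl, hb⟩ := v
  obtain ⟨a', k', i', w', b', hak', hki', hi', hw', hl', hb'⟩ := v'
  obtain ⟨h1, h2⟩ := h
  dsimp only at h1 h2 hv hv' hba hn han ⊢
  subst h1 h2 hw hw'
  simp only [and_self, if_true, outside_adjoin]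
  by_cases hkk : k = k'
  · subst hkk
    rw [hv.sum_conj_mul_self hv' (by omega) (by rw [card_coe_compl]; omega), card_coe_compl,
      binom_sub_eq han hak hki]
    by_cases hbb : b = b'
    · subst hbb
      have h3 := congrArg (fun x : ℝ => (x : ℂ)) (normCoeff_mul_self (n := n)
        (a := (supp w).card) hq hki (by omega))
      push_cast at h3
      rw [hn, mul_one, if_pos rfl, h3]
    · rw [if_neg (by rw [Index.mk.injEq]; simp [hbb])]
      have h4 : inner ℂ b b' = 0 := hba.1.2 (i := ⟨b, hb⟩) (j := ⟨b', hb'⟩) (by simpa using hbb)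
      rw [PiLp.inner_apply] at h4
      simp only [RCLike.inner_apply, mul_comm _ (conj _)] at h4
      rw [h4, mul_zero, mul_zero]
  · rw [if_neg (by rw [Index.mk.injEq]; simp [hkk]),
      hv.orthogonal hv' (by omega) (by omega) (by omega), mul_zero]

/-- The vectors `Psi` span: a vector orthogonal to all of them has vanishing character sums over
the words of each given support, hence is zero. -/
theorem span_Psi (hq : 2 ≤ q) (hφ : IsPrimitiveRoot φ (q - 1)) (hB : B.IsAdmissible) :
    Submodule.span ℂ (Set.range fun v : Index n q B => Psi φ v.a v.k v.i v.w v.b) = ⊤ := by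
  rw [← Submodule.orthogonal_eq_bot_iff, Submodule.eq_bot_iff]
  intro f hf
  rw [Submodule.mem_orthogonal] at hf
  -- For fixed `w` the character sums, as a function of the support, are orthogonal to all copies
  -- of harmonic functions on the complement of the support of `w`.
  have key : ∀ w : Word n q, (∀ h, (w h : ℕ) ≠ q - 1) → ∀ X : Finset (Fin n), supp w ⊆ X →
      ∑ x : Word n q with supp x = X, conj (φ ^ pairing w x) * f x = 0 := by
    intro w hw X hX
    have han : (supp w).card ≤ n := (card_le_univ _).trans_eq (Fintype.card_fin n)
    have h1 := eq_zero_of_orthogonal (V := ↥(supp w)ᶜ) (B := B (supp w)ᶜ)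
      (i := X.card - (supp w).card)
      (f := fun Z => if Z.card = X.card - (supp w).card then
        ∑ x : Word n q with supp x = adjoin (supp w) Z, conj (φ ^ pairing w x) * f x else 0)
      (fun k hk => (hB _ k (by rwa [Fintype.card_coe] at hk)).2)
      (fun I hI => if_neg hI) ?_ (outside (supp w) X)
    · simpa [card_outside _ hX, adjoin_outside _ hX] using h1
    · intro k hki hik b hb
      rw [card_coe_compl] at hik
      have hXc := card_le_card hX
      set v : Index n q B := ⟨(supp w).card, k + (supp w).card, X.card, w, b, by omega, by omega,
        by omega, rfl, hw, by rwa [Nat.add_sub_cancel]⟩ with hv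
      have h2 := hf _ (Submodule.subset_span ⟨v, rfl⟩)
      dsimp only at h2
      rw [inner_Psi_left v.card_supp v.a_le_k v.k_le_i (v.isHarmonic hB)] at h2
      have h3 := normCoeff_mul_self (n := n) (a := (supp w).card) (k := k + (supp w).card)
        (i := X.card) hq (by omega) (by omega)
      have h4 : normCoeff n q (supp w).card (k + (supp w).card) X.card ≠ 0 := by
        intro h5
        rw [h5] at h3
        simp at h3
      have h6 := (mul_eq_zero.mp h2).resolve_left (Complex.ofReal_ne_zero.mpr h4)
      simpa only [mul_ite, mul_zero, ← sum_filter] using h6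
  ext y
  have h1 : ∑ w : Word n q with supp w ⊆ supp y ∧ ∀ h, (w h : ℕ) ≠ q - 1, φ ^ pairing w y *
      ∑ x : Word n q with supp x = supp y, conj (φ ^ pairing w x) * f x = 0 :=
    sum_eq_zero fun w hw => by
      have hw := (mem_filter.mp hw).2
      rw [key w hw.2 _ hw.1, mul_zero]
  simp only [mul_sum] at h1
  rw [sum_comm] at h1
  have h2 : ∀ x ∈ univ.filter (fun x : Word n q => supp x = supp y),
      ∑ w : Word n q with supp w ⊆ supp y ∧ ∀ h, (w h : ℕ) ≠ q - 1,
        φ ^ pairing w y * (conj (φ ^ pairing w x) * f x) =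
      if x = y then ((q : ℂ) - 1) ^ (supp y).card * f x else 0 := fun x hx => by
    rw [← ite_zero_mul, ← sum_pairing_conj hq hφ x y (mem_filter.mp hx).2, sum_mul]
    exact sum_congr rfl fun w _ => by ring
  rw [sum_congr rfl h2, sum_ite_eq',
    if_pos (show y ∈ univ.filter fun x : Word n q => supp x = supp y from
      mem_filter.mpr ⟨mem_univ _, rfl⟩)] at h1
  have h3 : (q : ℂ) - 1 ≠ 0 := by
    rw [sub_ne_zero]
    exact_mod_cast (show q ≠ 1 by omega)
  exact (mul_eq_zero.mp h1).resolve_left (pow_ne_zero _ h3)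

theorem alpha_eq (i j t p a k : ℕ) : alpha n q i j t p a k =
    beta (n - a) ((t : ℤ) - a) ((i : ℤ) - a) ((j : ℤ) - a) ((k : ℤ) - a) *
      ((q : ℝ) - 1) ^ (((i : ℝ) + j) / 2 - t) * agreementCoeff q t p a := rfl

/-- For `t < a` every summand of `beta` contains a binomial coefficient with negative lower
index. -/
theorem alpha_eq_zero {t a : ℕ} (hta : t < a) (i j p k : ℕ) : alpha n q i j t p a k = 0 := by
  have h : beta (n - a) ((t : ℤ) - a) ((i : ℤ) - a) ((j : ℤ) - a) ((k : ℤ) - a) = 0 := by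
    rw [beta, sum_eq_zero, mul_zero]
    intro r _
    rw [show binom ((i : ℤ) - a - r) ((t : ℤ) - a - r) = 0 from if_neg (by omega)]
    simp
  rw [alpha_eq, h, zero_mul, zero_mul]

theorem M_Psi_of_ne {i j t p : ℕ} (hB : B.IsAdmissible) (v : Index n q B) (hi : i ≠ v.i) :
    Matrix.toEuclideanLin (M n q j i t p) (Psi φ v.a v.k v.i v.w v.b) = 0 := by
  ext u
  change ∑ x, M n q j i t p u x * Psi φ v.a v.k v.i v.w v.b x = 0
  refine sum_eq_zero fun x _ => ?_
  rw [Psi_apply v.card_supp v.a_le_k v.k_le_i (v.isHarmonic hB), M, Matrix.of_apply]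
  by_cases h : (supp x).card = i
  · rw [if_neg fun h' : supp v.w ⊆ supp x ∧ (supp x).card = v.i => hi (h.symm.trans h'.2),
      mul_zero]
  · rw [if_neg fun h' => h h'.2.1, zero_mul]

theorem M_Psi_eq_zero {i j t p : ℕ} (hq : 2 ≤ q) (hφ : IsPrimitiveRoot φ (q - 1))
    (hB : B.IsAdmissible) (hti : t ≤ i) (v : Index n q B)
    (hj : ¬ (v.k ≤ j ∧ (j : ℤ) ≤ n + v.a - v.k)) :
    Matrix.toEuclideanLin (M n q j i t p) (Psi φ v.a v.k v.i v.w v.b) = 0 := by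
  by_cases hi : i = v.i
  swap
  · exact M_Psi_of_ne hB v hi
  ext u
  subst hi
  rw [M_Psi_apply hq hφ v.letter_ne v.card_supp v.a_le_k v.k_le_i (v.isHarmonic hB) hti]
  split_ifs with h
  · have h1 := v.a_le_k
    have h2 := v.a_le
    have h3 := card_le_card h.1
    have h4 := v.card_supp
    rw [(v.isHarmonic hB).upSum_eq_zero, mul_zero, mul_zero]
    · rfl
    · rw [card_outside _ h.1, card_coe_compl, h.2.1]
      omega
  · rfl

/-- The scalar from `M_Psi_apply` is brought to the form of the theorem by `IsHarmonic.beta_symm`,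
the direct computation having produced the sum with `i` and `j` exchanged. -/
theorem M_Psi_eq {i j t p : ℕ} (hq : 2 ≤ q) (hφ : IsPrimitiveRoot φ (q - 1))
    (hB : B.IsAdmissible) (hti : t ≤ i) (htj : t ≤ j) (v : Index n q B) (hi : i = v.i)
    (hkj : v.k ≤ j) (hj : (j : ℤ) ≤ n + v.a - v.k) :
    Matrix.toEuclideanLin (M n q j i t p) (Psi φ v.a v.k v.i v.w v.b) =
      (((binom ((n : ℤ) + v.a - 2 * v.k) ((i : ℤ) - v.k) : ℝ) ^ (-(1 / 2) : ℝ) *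
          (binom ((n : ℤ) + v.a - 2 * v.k) ((j : ℤ) - v.k) : ℝ) ^ (-(1 / 2) : ℝ) *
          alpha n q i j t p v.a v.k : ℝ) : ℂ) • Psi φ v.a v.k j v.w v.b := by
  subst hi
  have hak := v.a_le_k
  have hki := v.k_le_i
  have hik := v.i_le
  have han := v.a_le
  have hb := v.isHarmonic hB
  ext u
  rw [M_Psi_apply hq hφ v.letter_ne v.card_supp hak hki hb hti, PiLp.smul_apply, smul_eq_mul,
    Psi_apply v.card_supp hak hkj hb]
  by_cases h : supp v.w ⊆ supp u ∧ (supp u).card = j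
  swap
  · rw [if_neg fun h' => h ⟨h'.1, h'.2.1⟩, if_neg h, mul_zero]
  by_cases hat : v.a ≤ t
  swap
  · rw [if_neg fun h' => hat h'.2.2, alpha_eq_zero (by omega)]; simp
  rw [if_pos ⟨h.1, h.2, hat⟩, if_pos h]
  have hcard : Fintype.card ↥(supp v.w)ᶜ = n - v.a := by rw [card_coe_compl, v.card_supp]
  have hsymm := hb.beta_symm (i := v.i - v.a) (j := j - v.a) (t := t - v.a)
    (by rw [v.sum_conj_mul_self hB]; exact one_ne_zero) (by omega) (by omega) (by omega)
    (by rw [hcard]; omega) (by omega) (by rw [hcard]; omega)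
  rw [hcard, beta_eq (n - v.a) _ (j - v.a : ℕ), binom_sub_eq han hak hkj] at hsymm
  have hN : (0 : ℝ) < (binom ((n : ℤ) + v.a - 2 * v.k) ((j : ℤ) - v.k) : ℝ) :=
    Nat.cast_pos.mpr (binom_pos (by omega) (by omega))
  have hq' : (0 : ℝ) < (q : ℝ) - 1 := by
    have : (2 : ℝ) ≤ q := by exact_mod_cast hq
    linarith
  have hpow : ((q : ℝ) - 1) ^ (((v.i : ℝ) + j) / 2 - t) * ((q : ℝ) - 1) ^ (-(j : ℝ) / 2) =
      ((q : ℝ) - 1) ^ (-(v.i : ℝ) / 2) * ((q : ℝ) - 1) ^ (v.i - t) := by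
    rw [← Real.rpow_natCast, Nat.cast_sub hti, ← Real.rpow_add hq', ← Real.rpow_add hq']
    congr 1
    ring
  have hhalf := rpow_neg_half_mul_self hN
  have hreal : normCoeff n q v.a v.k v.i * (((q : ℝ) - 1) ^ (v.i - t) * agreementCoeff q t p v.a) *
      layerCoeff (n - v.a) (t - v.a : ℕ) (j - v.a : ℕ) (v.i - v.a : ℕ) (v.k - v.a : ℕ) =
      (binom ((n : ℤ) + v.a - 2 * v.k) ((v.i : ℤ) - v.k) : ℝ) ^ (-(1 / 2) : ℝ) *
          (binom ((n : ℤ) + v.a - 2 * v.k) ((j : ℤ) - v.k) : ℝ) ^ (-(1 / 2) : ℝ) *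
          alpha n q v.i j t p v.a v.k * normCoeff n q v.a v.k j := by
    rw [alpha_eq, ← Nat.cast_sub hat, ← Nat.cast_sub (hak.trans hki), ← Nat.cast_sub hak,
      ← Nat.cast_sub (hak.trans hkj), hsymm, normCoeff, normCoeff]
    generalize layerCoeff _ _ _ _ _ = l
    generalize agreementCoeff _ _ _ _ = g
    generalize (binom ((n : ℤ) + v.a - 2 * v.k) ((v.i : ℤ) - v.k) : ℝ) ^ (-(1 / 2) : ℝ) = y
    generalize (binom ((n : ℤ) + v.a - 2 * v.k) ((j : ℤ) - v.k) : ℝ) ^ (-(1 / 2) : ℝ) = z at *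
    generalize (binom ((n : ℤ) + v.a - 2 * v.k) ((j : ℤ) - v.k) : ℝ) = N at *
    linear_combination (-(y * g * l)) * hpow * (z * z * N) - y * g * l *
      (((q : ℝ) - 1) ^ (-(v.i : ℝ) / 2) * ((q : ℝ) - 1) ^ (v.i - t)) * hhalf
  -- Only the real scalars differ; the character and the value of `upSum` are common factors.
  have hcomplex := congrArg (fun x : ℝ => (x : ℂ)) hreal
  push_cast at hcomplex ⊢
  linear_combination (φ ^ pairing v.w u * upSum v.b.ofLp (outside (supp v.w) (supp u))) * hcomplex

end Basis

end HammingTerwilliger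

theorem mainTheorem2 (n q : ℕ) (hn : 1 ≤ n) (hq : 2 ≤ q)
    (φ : ℂ) (hφ : IsPrimitiveRoot φ (q - 1))
    (B : HammingTerwilliger.BaseFamily n) (hB : B.IsAdmissible) :
    -- the vectors `Ψ` form an orthonormal base of the space of complex functions on words
    (Orthonormal ℂ (fun v : HammingTerwilliger.Index n q B =>
        HammingTerwilliger.Psi φ v.a v.k v.i v.w v.b) ∧
      Submodule.span ℂ (Set.range fun v : HammingTerwilliger.Index n q B =>
        HammingTerwilliger.Psi φ v.a v.k v.i v.w v.b) = ⊤) ∧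
    -- the action of the matrices `M_{j,i}^{t,p}` on this base
    ∀ i j t p : ℕ, (i, j, t, p) ∈ HammingTerwilliger.tuples q n →
      ∀ v : HammingTerwilliger.Index n q B,
        ((v.k ≤ j ∧ (j : ℤ) ≤ n + v.a - v.k) →
          Matrix.toEuclideanLin (HammingTerwilliger.M n q j i t p)
              (HammingTerwilliger.Psi φ v.a v.k v.i v.w v.b) =
            (if i = v.i then
              (((HammingTerwilliger.binom ((n : ℤ) + v.a - 2 * v.k) ((i : ℤ) - v.k) : ℝ)
                    ^ (-(1 / 2) : ℝ) *
                  (HammingTerwilliger.binom ((n : ℤ) + v.a - 2 * v.k) ((j : ℤ) - v.k) : ℝ)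
                    ^ (-(1 / 2) : ℝ) *
                  HammingTerwilliger.alpha n q i j t p v.a v.k : ℝ) : ℂ)
              else 0) • HammingTerwilliger.Psi φ v.a v.k j v.w v.b) ∧
        (¬ (v.k ≤ j ∧ (j : ℤ) ≤ n + v.a - v.k) →
          Matrix.toEuclideanLin (HammingTerwilliger.M n q j i t p)
              (HammingTerwilliger.Psi φ v.a v.k v.i v.w v.b) = 0) := by
  refine ⟨⟨HammingTerwilliger.orthonormal_Psi hq hφ hB, HammingTerwilliger.span_Psi hq hφ hB⟩, ?_⟩
  rintro i j t p ⟨-, hti, htj, -, -⟩ v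
  refine ⟨fun hj => ?_, HammingTerwilliger.M_Psi_eq_zero hq hφ hB hti v⟩
  split_ifs with hi
  · exact HammingTerwilliger.M_Psi_eq hq hφ hB hti htj v hi hj.1 hj.2
  · rw [zero_smul]
    exact HammingTerwilliger.M_Psi_of_ne hB v hi
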